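/- Let $R$ be a complete discrete valuation ring with normalized valuation $v$, fraction field $K$ and finite residue field $k$ of characteristic $p$ with $q$ elements. For an endomorphism $f$ of an $S$-scheme, the primitive period of a periodic $S$-point $Q$ is the least $j\ge 1$ with $f^j(Q)=Q$. An endomorphism $\psi$ of a $K$-scheme $Y$ has good reduction if there are a smooth proper $R$-scheme $\mathcal Y$ with generic fibre $Y$ and an $R$-morphism $\psi_R:\mathcal Y\to\mathcal Y$ extending $\psi$; a pair $(\mathcal Y,\psi_R)$ is called a model of $\psi$. Write $\overline{\psi}$ for the restriction of $\psi_R$ to the special fibre $\mathcal Y_k$. Let $X$ be a projective variety over $K$ (reduced, not necessarily smooth or irreducible), let $\phi:X\to X$ be an étale $K$-morphism, and let $P\in X(K)$ be a smooth point which is periodic for $\phi$ with primitive period $n$. Let $Y$ be the irreducible component of the smooth locus $X_{\mathrm{smooth}}$ that contains $P$. Then there is a least integer $l\ge 1$ such that $\phi^l$ restricts to an étale endomorphism $\psi$ of $Y$. Suppose that $\psi=\phi^l|_Y$ has good reduction, and let $(\mathcal Y,\psi_R)$ be any model of it. Then $P$ extends to a point $P_R\in\mathcal Y(R)$. Let $\overline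 P\in\mathcal Y_k(k)$ be its reduction, and let $m$ be the primitive period of $\overline P$ under $\overline\psi$. Let $\mathcal V\subset\mathcal Y$ be the scheme-theoretic union of the finite orbit $\{P_R,\psi_R(P_R),\psi_R^2(P_R),\dots\}$, let $V$ be the cotangent space of $\mathcal V\times_R\operatorname{Spec}k$ at $\overline P$, let $d'=\dim_k V$, and let $r_V$ be the order of the linear map induced by $\overline\psi^{\,m}$ on $V$. Then either $$n=lm,$$ or all of the following hold: 1. $V$ is isomorphic, compatibly with the maps induced by $\overline\psi^{\,m}$, to a $\overline\psi^{\,m}$-stable subspace of the cotangent space of $\mathcal Y_k$ at $\overline P$; 2. $d'\le\dim Y$ and $r_V\le q^{d'}-1$; 3. either $n=l\,m\,r_V$, or $n=l\,m\,r_V\,p^e$ for an integer $e\ge 0$ such that, if $p\ne 0$ in $K$, $$e\le\begin{cases}1+\log_2 v(p) & p\neq 2,\\[2pt] 1+\log_\alpha\!\left(\dfrac{\sqrt5\,v(2)+\sqrt{5\,v(2)^2+4}}{2}\right) & p=2,\end{cases}\qquad \alpha=\frac{1+\sqrt5}{2}.$$ -/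

import Mathlib

open CategoryTheory CategoryTheory.Limits AlgebraicGeometry

universe u

noncomputable section

namespace EtalePeriodic

/-! ### Schemes over a base, their sections, and iteration -/

/-- `X(S)`: the set of sections `S ⟶ X` of an `S`-scheme `X`. -/
abbrev Point {S : Scheme.{u}} (X : Over S) := Over.mk (𝟙 S) ⟶ X

/-- The `l`-th iterate of an endomorphism. -/
def iter {S : Scheme.{u}} {X : Over S} (φ : X ⟶ X) : ℕ → (X ⟶ X)
  | 0 => 𝟙 X
  | l + 1 => iter φ l ≫ φ

@[simp]
theorem iter_zero {S : Scheme.{u}} {X : Over S} (φ : X ⟶ X) : iter φ 0 = 𝟙 X := rfl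

theorem iter_succ {S : Scheme.{u}} {X : Over S} (φ : X ⟶ X) (l : ℕ) :
    iter φ (l + 1) = iter φ l ≫ φ := rfl

/-- The primitive period of the point `P ∈ X(S)` under `φ`, i.e. the least `n ≥ 1` with
`φⁿ(P) = P`; it is `0` if `P` is not periodic. -/
def primitivePeriod {S : Scheme.{u}} {X : Over S} (φ : X ⟶ X) (P : Point X) : ℕ :=
  Function.minimalPeriod (fun Q : Point X => Q ≫ φ) P

theorem iterate_eq_comp_iter {S : Scheme.{u}} {X : Over S} (φ : X ⟶ X) (P : Point X) (l : ℕ) :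
    (fun Q : Point X => Q ≫ φ)^[l] P = P ≫ iter φ l := by
  induction l with
  | zero => simp
  | succ l ih => rw [Function.iterate_succ_apply', ih, iter_succ, Category.assoc]

theorem comp_iter_primitivePeriod {S : Scheme.{u}} {X : Over S} (φ : X ⟶ X) (P : Point X) :
    P ≫ iter φ (primitivePeriod φ P) = P := by
  rw [← iterate_eq_comp_iter]
  exact Function.iterate_minimalPeriod

theorem iter_comm {S : Scheme.{u}} {X X' : Over S} (φ : X ⟶ X) (φ' : X' ⟶ X') (i : X ⟶ X')
    (h : φ ≫ i = i ≫ φ') (l : ℕ) : iter φ l ≫ i = i ≫ iter φ' l := by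
  induction l with
  | zero => simp
  | succ l ih => rw [iter_succ, iter_succ, Category.assoc, h, reassoc_of% ih]

/-- The base change `X ×_S T` of an `S`-scheme along `s : T ⟶ S`, as a `T`-scheme. -/
abbrev baseChange {S T : Scheme.{u}} (s : T ⟶ S) (X : Over S) : Over T :=
  (Over.pullback s).obj X

/-- The base change of a morphism of `S`-schemes. -/
abbrev baseChangeMap {S T : Scheme.{u}} (s : T ⟶ S) {X X' : Over S} (f : X ⟶ X') :
    baseChange s X ⟶ baseChange s X' :=
  (Over.pullback s).map f

/-- The base change in `(X ×_S T)(T)` of a point of `X(S)`. -/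
def baseChangePoint {S T : Scheme.{u}} (s : T ⟶ S) {X : Over S} (P : Point X) :
    Point (baseChange s X) :=
  Over.homMk (pullback.lift (s ≫ P.left) (𝟙 T) (by
    have h : P.left ≫ X.hom = 𝟙 S := Over.w P
    rw [Category.assoc, h, Category.comp_id]; exact (Category.id_comp s).symm)) (pullback.lift_snd _ _ _)

theorem baseChangePoint_comp {S T : Scheme.{u}} (s : T ⟶ S) {X X' : Over S} (P : Point X)
    (f : X ⟶ X') :
    baseChangePoint s P ≫ baseChangeMap s f = baseChangePoint s (P ≫ f) := by
  ext1
  change pullback.lift (s ≫ P.left) (𝟙 T) _ ≫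
    pullback.lift (pullback.fst X.hom s ≫ f.left) (pullback.snd X.hom s) _ =
    pullback.lift (s ≫ P.left ≫ f.left) (𝟙 T) _
  apply pullback.hom_ext
  · rw [Category.assoc, pullback.lift_fst, pullback.lift_fst_assoc, pullback.lift_fst,
      Category.assoc]
  · rw [Category.assoc, pullback.lift_snd, pullback.lift_snd, pullback.lift_snd]

/-! ### Projective varieties and the smooth locus -/

section

attribute [local instance] MvPolynomial.gradedAlgebra

/-- Projective `N`-space over `K`. -/
def projectiveSpace (N : ℕ) (K : Type u) [Field K] : Over (Spec (.of K)) :=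
  Over.mk (Proj.toSpecZero (MvPolynomial.homogeneousSubmodule (Fin (N + 1)) K) ≫
    Spec.map (CommRingCat.ofHom
      (algebraMap K (MvPolynomial.homogeneousSubmodule (Fin (N + 1)) K 0))))

end

/-- A projective variety over `K`: a reduced closed subscheme of some projective space. It may be
singular and reducible. -/
structure IsProjectiveVariety {K : Type u} [Field K] (X : Over (Spec (.of K))) : Prop where
  reduced : IsReduced X.left
  projective : ∃ (N : ℕ) (i : X ⟶ projectiveSpace N K), IsClosedImmersion i.left

/-- The set of points of `X` at which `X` is smooth over `S`. -/
def smoothLocus {S : Scheme.{u}} (X : Over S) : Set X.left :=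
  {x | ∃ U : X.left.Opens, x ∈ U ∧ Smooth (U.ι ≫ X.hom)}

/-- An open subscheme of an `S`-scheme, as an `S`-scheme. -/
abbrev openSubscheme {S : Scheme.{u}} {X : Over S} (U : X.left.Opens) : Over S :=
  Over.mk (U.ι ≫ X.hom)

/-- The inclusion of an open subscheme. -/
abbrev openInclusion {S : Scheme.{u}} {X : Over S} (U : X.left.Opens) : openSubscheme U ⟶ X :=
  Over.homMk U.ι

/-! ### Good reduction -/

/-- The generic point `Spec K ⟶ Spec R`. -/
abbrev genericPt (R K : Type u) [CommRing R] [Field K] [Algebra R K] :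
    Spec (.of K) ⟶ Spec (.of R) :=
  Spec.map (CommRingCat.ofHom (algebraMap R K))

/-- The closed point `Spec k ⟶ Spec R`. -/
abbrev closedPt (R : Type u) [CommRing R] [IsLocalRing R] :
    Spec (.of (IsLocalRing.ResidueField R)) ⟶ Spec (.of R) :=
  Spec.map (CommRingCat.ofHom (IsLocalRing.residue R))

/-- A model over `R` witnessing the good reduction of the `K`-endomorphism `ψ` of `Y`: a smooth
proper `R`-scheme with generic fibre `Y`, and an `R`-endomorphism of it which extends `ψ`. -/
structure GoodReductionModel (R : Type u) {K : Type u} [CommRing R] [Field K] [Algebra R K]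
    {Y : Over (Spec (.of K))} (ψ : Y ⟶ Y) where
  scheme : Over (Spec (.of R))
  smooth : Smooth scheme.hom
  proper : IsProper scheme.hom
  genericIso : baseChange (genericPt R K) scheme ≅ Y
  map : scheme ⟶ scheme
  comm : baseChangeMap (genericPt R K) map ≫ genericIso.hom = genericIso.hom ≫ ψ

/-! ### Cotangent spaces at rational points -/

section Cotangent

variable {k : Type u} [Field k]

/-- The point of the underlying space given by a rational point. -/
def Point.pt {Z : Over (Spec (.of k))} (x : Point Z) : Z.left :=
  x.left (IsLocalRing.closedPoint k)

/-- The local ring of `Z` at a rational point. -/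
def LocalRingAt {Z : Over (Spec (.of k))} (x : Point Z) : Type u :=
  Z.left.presheaf.stalk x.pt

instance {Z : Over (Spec (.of k))} (x : Point Z) : CommRing (LocalRingAt x) :=
  inferInstanceAs (CommRing (Z.left.presheaf.stalk x.pt))

instance {Z : Over (Spec (.of k))} (x : Point Z) : IsLocalRing (LocalRingAt x) :=
  inferInstanceAs (IsLocalRing (Z.left.presheaf.stalk x.pt))

/-- The structure map `k → 𝒪_{Z,x}`. -/
def structureMapAt (Z : Over (Spec (.of k))) (z : Z.left) :
    CommRingCat.of k ⟶ Z.left.presheaf.stalk z :=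
  (Scheme.ΓSpecIso (.of k)).inv ≫ Z.hom.appTop ≫ Z.left.presheaf.germ ⊤ z (TopologicalSpace.Opens.mem_top z)

instance {Z : Over (Spec (.of k))} (x : Point Z) : Algebra k (LocalRingAt x) :=
  (structureMapAt Z x.pt).hom.toAlgebra

/-- The cotangent space `𝔪 / 𝔪²` of `Z` at a rational point, a `k`-vector space. -/
abbrev CotangentAt {Z : Over (Spec (.of k))} (x : Point Z) : Type u :=
  IsLocalRing.CotangentSpace (LocalRingAt x)

theorem pt_comp {Z Z' : Over (Spec (.of k))} (f : Z ⟶ Z') (x : Point Z) (x' : Point Z')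
    (h : x ≫ f = x') : x'.pt = f.left x.pt := by
  subst h
  rfl

/-- The homomorphism of local rings `𝒪_{Z',x'} → 𝒪_{Z,x}` induced by `f : Z ⟶ Z'` with
`f(x) = x'`. -/
def localRingHom {Z Z' : Over (Spec (.of k))} (f : Z ⟶ Z') (x : Point Z) (x' : Point Z')
    (h : x ≫ f = x') :
    Z'.left.presheaf.stalk x'.pt ⟶ Z.left.presheaf.stalk x.pt :=
  (Z'.left.presheaf.stalkCongr (.of_eq (pt_comp f x x' h))).hom ≫ f.left.stalkMap x.pt

theorem structureMapAt_localRingHom {Z Z' : Over (Spec (.of k))} (f : Z ⟶ Z') (x : Point Z)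
    (x' : Point Z') (h : x ≫ f = x') :
    structureMapAt Z' x'.pt ≫ localRingHom f x x' h = structureMapAt Z x.pt := by
  have hf : Z.hom = f.left ≫ Z'.hom := (Over.w f).symm
  have h1 : Z'.left.presheaf.germ ⊤ x'.pt (TopologicalSpace.Opens.mem_top x'.pt) ≫ localRingHom f x x' h =
      f.left.appTop ≫ Z.left.presheaf.germ ⊤ x.pt (TopologicalSpace.Opens.mem_top x.pt) := by
    unfold localRingHom
    rw [TopCat.Presheaf.stalkCongr_hom, ← Category.assoc]
    refine (congrArg (· ≫ f.left.stalkMap x.pt) (TopCat.Presheaf.germ_stalkSpecializes _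
      (TopologicalSpace.Opens.mem_top _) _)).trans ?_
    exact Scheme.Hom.germ_stalkMap f.left ⊤ x.pt (TopologicalSpace.Opens.mem_top _)
  unfold structureMapAt
  rw [Category.assoc, Category.assoc, h1, hf, Scheme.Hom.comp_appTop, Category.assoc]

instance {Z Z' : Over (Spec (.of k))} (f : Z ⟶ Z') (x : Point Z) (x' : Point Z')
    (h : x ≫ f = x') : IsLocalHom (localRingHom f x x' h).hom := by
  unfold localRingHom
  infer_instance

/-- `localRingHom` as a homomorphism of `k`-algebras. -/
def localAlgHom {Z Z' : Over (Spec (.of k))} (f : Z ⟶ Z') (x : Point Z) (x' : Point Z')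
    (h : x ≫ f = x') : LocalRingAt x' →ₐ[k] LocalRingAt x :=
  { (localRingHom f x x' h).hom with
    commutes' := fun c =>
      congr($(structureMapAt_localRingHom f x x' h) c) }

/-- The `k`-linear map of cotangent spaces induced by `f : Z ⟶ Z'` with `f(x) = x'`. -/
def cotangentMap {Z Z' : Over (Spec (.of k))} (f : Z ⟶ Z') (x : Point Z) (x' : Point Z')
    (h : x ≫ f = x') : CotangentAt x' →ₗ[k] CotangentAt x :=
  Ideal.mapCotangent _ _ (localAlgHom f x x' h) (by
    have : IsLocalHom (localAlgHom f x x' h).toRingHom :=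
      inferInstanceAs (IsLocalHom (localRingHom f x x' h).hom)
    exact ((IsLocalRing.local_hom_TFAE (localAlgHom f x x' h).toRingHom).out 0 3).mp this)

end Cotangent

/-! ### The scheme-theoretic union of the orbit of a point -/

section Orbit

variable {S : Scheme.{u}} {X : Over S} (φ : X ⟶ X) (P : Point X)

/-- The intersection of the ideal sheaves of the sections `P, φ(P), φ²(P), …`. -/
def orbitIdeal : X.left.IdealSheafData :=
  ⨅ i : ℕ, (P ≫ iter φ i).left.ker

/-- For a periodic point the orbit is the finite set `P, φ(P), …, φⁿ⁻¹(P)`, with `n` the primitive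
period. -/
theorem orbitIdeal_eq (hn : 0 < primitivePeriod φ P) :
    orbitIdeal φ P = ⨅ i : Fin (primitivePeriod φ P), (P ≫ iter φ i).left.ker := by
  apply le_antisymm
  · exact le_iInf fun i => iInf_le _ (i : ℕ)
  · refine le_iInf fun i => ?_
    refine (iInf_le _ (⟨i % primitivePeriod φ P, Nat.mod_lt _ hn⟩ : Fin _)).trans_eq ?_
    rw [← iterate_eq_comp_iter, ← iterate_eq_comp_iter]
    exact congrArg (fun Q : Point X => Q.left.ker) Function.iterate_mod_minimalPeriod_eq

/-- The scheme-theoretic union of the orbit of `P`, a closed subscheme of `X`. -/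
def orbit : Over S := Over.mk ((orbitIdeal φ P).subschemeι ≫ X.hom)

/-- The inclusion of the orbit. -/
def orbitι : orbit φ P ⟶ X := Over.homMk (orbitIdeal φ P).subschemeι

theorem orbitIdeal_le_map : orbitIdeal φ P ≤ (orbitIdeal φ P).map φ.left := by
  have h : (orbitIdeal φ P).map φ.left = ⨅ i : ℕ, ((P ≫ iter φ i).left.ker).map φ.left :=
    (Scheme.IdealSheafData.map_gc φ.left).u_iInf
  rw [h]
  refine le_iInf fun i => (iInf_le _ (i + 1)).trans_eq ?_
  rw [Scheme.IdealSheafData.map_ker, iter_succ, ← Category.assoc, Over.comp_left]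

/-- The endomorphism of the orbit of `P` obtained by restricting `φ`. -/
def orbitMap : orbit φ P ⟶ orbit φ P :=
  Over.homMk ((orbitIdeal φ P).subschemeMap (orbitIdeal φ P) φ.left (orbitIdeal_le_map φ P)) (by
    simp [orbit])

/-- The point `P`, as a point of its orbit. -/
def orbitPoint : Point (orbit φ P) :=
  Over.homMk (show S ⟶ (orbitIdeal φ P).subscheme from
    IsClosedImmersion.lift (orbitIdeal φ P).subschemeι P.left (by
      rw [Scheme.IdealSheafData.ker_subschemeι]
      exact (iInf_le _ 0).trans_eq (by simp))) (by
    change IsClosedImmersion.lift _ _ _ ≫ (orbitIdeal φ P).subschemeι ≫ X.hom = 𝟙 S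
    rw [IsClosedImmersion.lift_fac_assoc]
    exact Over.w P)

theorem orbitMap_comp_orbitι : orbitMap φ P ≫ orbitι φ P = orbitι φ P ≫ φ := by
  ext1
  exact Scheme.IdealSheafData.subschemeMap_subschemeι _ _ _ (orbitIdeal_le_map φ P)

theorem orbitPoint_comp_orbitι : orbitPoint φ P ≫ orbitι φ P = P := by
  ext1
  exact IsClosedImmersion.lift_fac (orbitIdeal φ P).subschemeι P.left _

instance : Mono (orbitι φ P) := by
  have : Mono (orbitι φ P).left := inferInstanceAs (Mono (orbitIdeal φ P).subschemeι)
  exact Over.mono_of_mono_left _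

end Orbit

/-! ### Reduction modulo the maximal ideal -/

section Reduction

variable {R : Type u} [CommRing R] [IsLocalRing R] {X : Over (Spec (.of R))}
  (φ : X ⟶ X) (P : Point X)

/-- The primitive period of the reduction of `P` under the reduction of `φ`. -/
def reducedPeriod : ℕ :=
  primitivePeriod (baseChangeMap (closedPt R) φ) (baseChangePoint (closedPt R) P)

/-- The cotangent space, at the reduction of `P`, of the special fibre of `X`. -/
abbrev reducedCotangent : Type u := CotangentAt (baseChangePoint (closedPt R) P)

/-- The endomorphism induced on the cotangent space of the special fibre of `X` by the `m`-th
iterate of the reduction of `φ`, with `m` the primitive period of the reduction of `P`. -/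
def reducedCotangentMap :
    Module.End (IsLocalRing.ResidueField R) (reducedCotangent P) :=
  cotangentMap (iter (baseChangeMap (closedPt R) φ) (reducedPeriod φ P)) _ _
    (comp_iter_primitivePeriod _ _)

/-- The cotangent space, at the reduction of `P`, of the special fibre of the scheme-theoretic
union of the orbit of `P`. -/
abbrev orbitCotangent : Type u :=
  CotangentAt (baseChangePoint (closedPt R) (orbitPoint φ P))

theorem baseChangePoint_orbitPoint_fixed :
    baseChangePoint (closedPt R) (orbitPoint φ P) ≫
      iter (baseChangeMap (closedPt R) (orbitMap φ P)) (reducedPeriod φ P) =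
      baseChangePoint (closedPt R) (orbitPoint φ P) := by
  rw [← cancel_mono (baseChangeMap (closedPt R) (orbitι φ P)), Category.assoc,
    iter_comm _ (baseChangeMap (closedPt R) φ) _
      (by rw [← Functor.map_comp, ← Functor.map_comp, orbitMap_comp_orbitι]),
    ← Category.assoc, baseChangePoint_comp, orbitPoint_comp_orbitι]
  exact comp_iter_primitivePeriod _ _

/-- The endomorphism induced on `orbitCotangent` by the `m`-th iterate of the reduction of `φ`,
with `m` the primitive period of the reduction of `P`. -/
def orbitCotangentMap :
    Module.End (IsLocalRing.ResidueField R) (orbitCotangent φ P) :=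
  cotangentMap (iter (baseChangeMap (closedPt R) (orbitMap φ P)) (reducedPeriod φ P)) _ _
    (baseChangePoint_orbitPoint_fixed φ P)

end Reduction

/-- The bound on the exponent `e`, where `v` is the valuation of `p`. -/
def ExponentBound (p v e : ℕ) : Prop :=
  (p ≠ 2 → (e : ℝ) ≤ 1 + Real.logb 2 v) ∧
  (p = 2 → (e : ℝ) ≤ 1 + Real.logb Real.goldenRatio
    ((√5 * v + √(5 * (v : ℝ) ^ 2 + 4)) / 2))

end EtalePeriodic

end

/-! An étale map sends smooth points to smooth points, and `Y` is open and maximal among irreducible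
subsets of the smooth locus. So `φ^j` maps `Y` to itself exactly when `φ^j(P)` lies in `Y`. Such `j`
are closed under addition and include `n`, and membership depends only on `j` modulo `n`; hence the
least one, `l`, divides `n`, and `n = l * (period of P under ψ)`. By the valuative criteria `P`
extends to a section of the model with the same period.

Reduction splits off the factor `m`. To compute the remaining period `N`, the model is replaced by
the scheme-theoretic union of the orbit, on which `ψ_R^m` has finite order because the locus where
an iterate is the identity is closed. Let `A` be the local ring of this union along the section, `ε
: A → R` the augmentation, `I` its kernel, and `σ` the automorphism induced on `A`. Then `σ^N = 1`,
so the order `r` of the action on the cotangent space divides `N`, and `τ = σ^r` is the identity on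
`I` modulo `ϖR + ϖI + I²`.

The arithmetic core concerns such a `τ`. Expanding `τ^j = (1 + (τ - 1))^j` and using `ε ∘ τ^j = ε`
bounds `j ε(τ x)` by the higher binomial terms. For `j` prime to `p` this forces `ε ∘ τ = ε`
(`comp_eq_of_isUnit`), so the period of `ε` is a power of `p`. Passing to `p`-th powers makes `τ`
approach the identity, doubling the exponent for odd `p` and following the Fibonacci numbers for `p
= 2` (`exists_pow_prime_pow`), whereas a nontrivial action of order `p` cannot be closer to the
identity than `v(p)` allows (`le_of_comp_pow_eq`). The result is `minimalPeriod_eq`, assembled with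
the cotangent action in `minimalPeriod_eq_orderOf_mul`.

If the cotangent space vanishes, Nakayama's lemma gives `N = 1`, which is the first alternative.
Otherwise this space is a quotient of that of the special fibre. An endomorphism is isomorphic to
its transpose, so the quotient is also a stable subspace. Its dimension is bounded through a
standard smooth chart, and the order of the action by counting polynomials modulo the characteristic
polynomial. -/

namespace EtalePeriodic

/-! ### Endomorphisms of an augmented algebra that are close to the identity. -/

section Contraction

variable {R A : Type*} [CommRing R] [CommRing A] [Algebra R A]

/-- For an augmented algebra `ε : A → R` with augmentation ideal `I`, the `R`-submodule
`ϖᵃ R + ϖᵇ I + I²` of `A`. -/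
def augFiltration (ϖ : R) (ε : A →ₐ[R] R) (a b : ℕ) : Submodule R A where
  carrier := {x | ∃ c : R, ∃ y ∈ RingHom.ker ε, ∃ q ∈ RingHom.ker ε ^ 2,
    x = algebraMap R A (ϖ ^ a * c) + ϖ ^ b • y + q}
  add_mem' := by
    rintro _ _ ⟨c, y, hy, q, hq, rfl⟩ ⟨c', y', hy', q', hq', rfl⟩
    refine ⟨c + c', y + y', add_mem hy hy', q + q', add_mem hq hq', ?_⟩
    rw [mul_add, map_add, smul_add]
    ring
  zero_mem' := ⟨0, 0, zero_mem _, 0, zero_mem _, by simp⟩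
  smul_mem' := by
    rintro r _ ⟨c, y, hy, q, hq, rfl⟩
    refine ⟨r * c, r • y, Submodule.smul_of_tower_mem _ r hy, r • q,
      Submodule.smul_of_tower_mem _ r hq, ?_⟩
    simp only [Algebra.smul_def, map_mul, map_pow]
    ring

variable {ϖ : R} {ε : A →ₐ[R] R} {a b a' b' : ℕ}

theorem augFiltration_mono (ha : a' ≤ a) (hb : b' ≤ b) :
    augFiltration ϖ ε a b ≤ augFiltration ϖ ε a' b' := by
  rintro _ ⟨c, y, hy, q, hq, rfl⟩
  refine ⟨ϖ ^ (a - a') * c, ϖ ^ (b - b') • y, Submodule.smul_of_tower_mem _ _ hy, q, hq, ?_⟩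
  rw [← mul_assoc, ← pow_add, smul_smul, ← pow_add, Nat.add_sub_cancel' ha, Nat.add_sub_cancel' hb]

theorem smul_mem_augFiltration {x : A} (hx : x ∈ augFiltration ϖ ε a b) {s : R} {w : ℕ}
    (hs : ϖ ^ w ∣ s) : s • x ∈ augFiltration ϖ ε (a + w) (b + w) := by
  obtain ⟨t, rfl⟩ := hs
  obtain ⟨c, y, hy, q, hq, rfl⟩ := hx
  refine ⟨t * c, t • y, Submodule.smul_of_tower_mem _ _ hy, (ϖ ^ w * t) • q,
    Submodule.smul_of_tower_mem _ _ hq, ?_⟩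
  simp only [Algebra.smul_def, map_mul, map_pow, pow_add]
  ring

theorem augmentation_eq_zero_of_mem_sq {q : A} (hq : q ∈ RingHom.ker ε ^ 2) : ε q = 0 :=
  Ideal.pow_le_self two_ne_zero hq

theorem dvd_of_mem_augFiltration {x : A} (hx : x ∈ augFiltration ϖ ε a b) : ϖ ^ a ∣ ε x := by
  obtain ⟨c, y, hy, q, hq, rfl⟩ := hx
  have hy' : ε y = 0 := hy
  rw [map_add, map_add, AlgHom.commutes, map_smul, hy', augmentation_eq_zero_of_mem_sq hq]
  simp

/-- The terms in `I` and `I²` die under `ε`, so the constant term is exactly `ε x`. The first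
exponent can therefore be improved without touching the second. -/
theorem mem_augFiltration_of_dvd {x : A} (hx : x ∈ augFiltration ϖ ε a b) (h : ϖ ^ a' ∣ ε x) :
    x ∈ augFiltration ϖ ε a' b := by
  obtain ⟨c, y, hy, q, hq, rfl⟩ := hx
  have hy' : ε y = 0 := hy
  rw [map_add, map_add, AlgHom.commutes, map_smul, hy', augmentation_eq_zero_of_mem_sq hq] at h
  simp only [Algebra.algebraMap_self, RingHom.id_apply, smul_zero, add_zero] at h
  obtain ⟨d, hd⟩ := h
  exact ⟨d, y, hy, q, hq, by rw [hd]⟩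

/-- The ideal of the elements whose augmentation is divisible by `ϖᵃ`. -/
def augIdeal (ϖ : R) (ε : A →ₐ[R] R) (a : ℕ) : Ideal A := (Ideal.span {ϖ ^ a}).comap ε

theorem mem_augIdeal {x : A} : x ∈ augIdeal ϖ ε a ↔ ϖ ^ a ∣ ε x := by
  rw [augIdeal, Ideal.mem_comap, Ideal.mem_span_singleton]

theorem sub_algebraMap_mem_ker (x : A) : x - algebraMap R A (ε x) ∈ RingHom.ker ε := by
  rw [RingHom.mem_ker, map_sub, AlgHom.commutes]
  simp

/-- In a product `(ϖᵃc + y)(ϖᵃd + z)` with `y, z ∈ I`, the constant term has a factor `ϖ²ᵃ`, the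
cross terms lie in `ϖᵃI`, and `yz ∈ I²`. -/
theorem mem_augFiltration_of_mem_augIdeal_sq {x : A} (hx : x ∈ augIdeal ϖ ε a ^ 2) :
    x ∈ augFiltration ϖ ε (2 * a) a := by
  rw [pow_two] at hx
  refine Submodule.mul_induction_on hx (fun y hy z hz => ?_) fun _ _ => add_mem
  obtain ⟨c, hc⟩ := mem_augIdeal.mp hy
  obtain ⟨d, hd⟩ := mem_augIdeal.mp hz
  have hy' := sub_algebraMap_mem_ker (ε := ε) y
  have hz' := sub_algebraMap_mem_ker (ε := ε) z
  rw [hc] at hy'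
  rw [hd] at hz'
  refine ⟨c * d, c • (z - algebraMap R A (ϖ ^ a * d)) + d • (y - algebraMap R A (ϖ ^ a * c)),
    add_mem (Submodule.smul_of_tower_mem _ _ hz') (Submodule.smul_of_tower_mem _ _ hy'),
    (y - algebraMap R A (ϖ ^ a * c)) * (z - algebraMap R A (ϖ ^ a * d)), ?_, ?_⟩
  · rw [pow_two]
    exact Ideal.mul_mem_mul hy' hz'
  · simp only [Algebra.smul_def, map_mul, map_pow, pow_mul]
    ring

theorem ker_sq_le_augIdeal_sq : RingHom.ker ε ^ 2 ≤ augIdeal ϖ ε a ^ 2 :=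
  Ideal.pow_right_mono (fun x hx => mem_augIdeal.mpr (by
    rw [show ε x = 0 from hx]; exact dvd_zero _)) 2

/-- The endomorphism `τ` moves the augmentation by a multiple of `ϖᵃ` and is, to first order, the
identity modulo `ϖᵇ`. -/
def IsContraction (ϖ : R) (ε : A →ₐ[R] R) (τ : A →ₐ[R] A) (a b : ℕ) : Prop :=
  ∀ x ∈ RingHom.ker ε, τ x - x ∈ augFiltration ϖ ε a b

variable {τ : A →ₐ[R] A}

theorem IsContraction.map_augIdeal (h : IsContraction ϖ ε τ a b) {x : A}
    (hx : x ∈ augIdeal ϖ ε a) : τ x ∈ augIdeal ϖ ε a := by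
  rw [mem_augIdeal] at hx ⊢
  have h1 := dvd_of_mem_augFiltration (h _ (sub_algebraMap_mem_ker (ε := ε) x))
  have h2 : ε (τ (x - algebraMap R A (ε x)) - (x - algebraMap R A (ε x))) = ε (τ x) - ε x := by
    simp
  rw [h2] at h1
  exact (dvd_sub_left hx).mp h1

theorem IsContraction.map_augIdeal_sq (h : IsContraction ϖ ε τ a b) {x : A}
    (hx : x ∈ augIdeal ϖ ε a ^ 2) : τ x ∈ augIdeal ϖ ε a ^ 2 := by
  have h1 : (augIdeal ϖ ε a).map τ ≤ augIdeal ϖ ε a :=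
    Ideal.map_le_of_le_comap fun y hy => h.map_augIdeal hy
  have h2 := Ideal.mem_map_of_mem τ hx
  rw [Ideal.map_pow] at h2
  exact Ideal.pow_right_mono h1 2 h2

/-- Each application of `τ - 1` kills the constant term and spreads the linear term again by the
contraction hypothesis. Since `I²` need not be stable under `τ`, the quadratic error is kept in the
square of the larger ideal `augIdeal`, which is stable. -/
theorem IsContraction.pow_sub_one_mem (h : IsContraction ϖ ε τ a b) (i : ℕ) {x : A}
    (hx : x ∈ RingHom.ker ε) :
    ∃ c : R, ∃ y ∈ RingHom.ker ε, ∃ q ∈ augIdeal ϖ ε a ^ 2,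
      ((τ.toLinearMap - 1) ^ (i + 1)) x =
        algebraMap R A (ϖ ^ (a + i * b) * c) + ϖ ^ ((i + 1) * b) • y + q := by
  induction i with
  | zero =>
    obtain ⟨c, y, hy, q, hq, e⟩ := h x hx
    exact ⟨c, y, hy, q, ker_sq_le_augIdeal_sq hq, by simpa using e⟩
  | succ i ih =>
    obtain ⟨c, y, hy, q, hq, e⟩ := ih
    obtain ⟨c', y', hy', q', hq', e'⟩ := h y hy
    refine ⟨c', y', hy', ϖ ^ ((i + 1) * b) • q' + (τ q - q),
      add_mem (Submodule.smul_of_tower_mem _ _ (ker_sq_le_augIdeal_sq hq'))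
        (sub_mem (h.map_augIdeal_sq hq) hq), ?_⟩
    rw [pow_succ', Module.End.mul_apply, e]
    have e2 : (τ.toLinearMap - 1)
        (algebraMap R A (ϖ ^ (a + i * b) * c) + ϖ ^ ((i + 1) * b) • y + q) =
        ϖ ^ ((i + 1) * b) • (τ y - y) + (τ q - q) := by
      simp only [LinearMap.sub_apply, AlgHom.toLinearMap_apply, Module.End.one_apply, map_add,
        AlgHom.commutes, map_smul, smul_sub]
      ring
    rw [e2, e']
    simp only [Algebra.smul_def, map_mul, map_pow, pow_add, add_mul, one_mul]
    ring

theorem IsContraction.pow_sub_one_mem_sup (h : IsContraction ϖ ε τ a b) (i : ℕ) {x : A}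
    (hx : x ∈ RingHom.ker ε) :
    ((τ.toLinearMap - 1) ^ (i + 1)) x ∈
      augFiltration ϖ ε (a + i * b) ((i + 1) * b) ⊔ augFiltration ϖ ε (2 * a) a := by
  obtain ⟨c, y, hy, q, hq, e⟩ := h.pow_sub_one_mem i hx
  rw [e]
  exact Submodule.add_mem_sup ⟨c, y, hy, 0, zero_mem _, by simp⟩
    (mem_augFiltration_of_mem_augIdeal_sq hq)

theorem pow_apply_eq_sum (τ : A →ₐ[R] A) (j : ℕ) (x : A) :
    (τ ^ j) x - x =
      ∑ i ∈ Finset.range j, ((j.choose (i + 1) : ℕ) : R) • ((τ.toLinearMap - 1) ^ (i + 1)) x := by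
  have h1 : (τ ^ j) x = ((τ.toLinearMap - 1 + 1) ^ j) x := by
    rw [sub_add_cancel]
    induction j with
    | zero => simp
    | succ j ih => rw [pow_succ', pow_succ', AlgHom.mul_apply, ih]; rfl
  rw [h1, (Commute.one_right _).add_pow, LinearMap.sum_apply, Finset.sum_range_succ', add_sub_assoc]
  simp only [one_pow, mul_one, Nat.choose_zero_right, Nat.cast_one, pow_zero, Module.End.one_apply,
    sub_self, add_zero]
  exact Finset.sum_congr rfl fun i _ => by
    rw [Module.End.mul_apply, Module.End.natCast_apply, map_nsmul, Nat.cast_smul_eq_nsmul]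

/-- In the expansion of `τ^p - 1` the middle coefficients are divisible by `p`, giving the gain `w`.
The last term `(τ - 1)^p` gains from its `p` factors, and the quadratic errors contribute the limits
`2 * a` and `a`. -/
theorem IsContraction.pow_prime (h : IsContraction ϖ ε τ a b) {p w : ℕ} (hp : p.Prime)
    (hw : ϖ ^ w ∣ (p : R)) (ha1 : a' ≤ a + w) (ha2 : a' ≤ a + (p - 1) * b) (ha3 : a' ≤ 2 * a)
    (hb1 : b' ≤ b + w) (hb2 : b' ≤ p * b) (hb3 : b' ≤ a) :
    IsContraction ϖ ε (τ ^ p) a' b' := by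
  intro x hx
  rw [pow_apply_eq_sum]
  refine sum_mem fun i hi => ?_
  rw [Finset.mem_range] at hi
  obtain ⟨y, hy, z, hz, e⟩ := Submodule.mem_sup.mp (h.pow_sub_one_mem_sup i hx)
  rw [← e, smul_add]
  refine add_mem ?_ (Submodule.smul_mem _ _ (augFiltration_mono ha3 hb3 hz))
  rcases (Nat.succ_le_of_lt hi).lt_or_eq with hlt | heq
  · have hdvd : ϖ ^ w ∣ ((p.choose (i + 1) : ℕ) : R) :=
      hw.trans (Nat.cast_dvd_cast (hp.dvd_choose_self (Nat.succ_ne_zero i) hlt))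
    refine augFiltration_mono ?_ ?_ (smul_mem_augFiltration hy hdvd)
    · exact ha1.trans (by omega)
    · exact hb1.trans (by nlinarith)
  · refine Submodule.smul_mem _ _ (augFiltration_mono ?_ ?_ hy)
    · exact ha2.trans (by rw [← heq]; simp)
    · exact hb2.trans (by rw [← heq])

theorem dvd_of_mem_augFiltration_sup {x : A} {c : ℕ} 
    (hx : x ∈ augFiltration ϖ ε a b ⊔ augFiltration ϖ ε a' b') (h : c ≤ a) (h' : c ≤ a') :
    ϖ ^ c ∣ ε x := by
  obtain ⟨y, hy, z, hz, rfl⟩ := Submodule.mem_sup.mp hx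
  rw [map_add]
  exact dvd_add ((pow_dvd_pow _ h).trans (dvd_of_mem_augFiltration hy))
    ((pow_dvd_pow _ h').trans (dvd_of_mem_augFiltration hz))

/-- If `ε ∘ τʲ = ε`, then `j ε(τ x)` is as divisible as the higher terms of the binomial
expansion. -/
theorem IsContraction.dvd_natCast_mul (h : IsContraction ϖ ε τ a b) {j c : ℕ} (hj : 0 < j)
    (hfix : ε.comp (τ ^ j) = ε)
    -- The index `i` stands for the binomial term of degree `i + 1`; `i = 0` is the linear term
    -- being estimated.
    (hc : ∀ i < j, 0 < i → ∃ w, ϖ ^ w ∣ ((j.choose (i + 1) : ℕ) : R) ∧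
      c ≤ w + (a + i * b) ∧ c ≤ w + 2 * a) {x : A} (hx : x ∈ RingHom.ker ε) :
    ϖ ^ c ∣ (j : R) * ε (τ x) := by
  have hx0 : ε x = 0 := hx
  have h1 : ε ((τ ^ j) x - x) = 0 := by
    rw [map_sub, sub_eq_zero]
    exact DFunLike.congr_fun hfix x
  rw [pow_apply_eq_sum, map_sum] at h1
  obtain ⟨j, rfl⟩ := Nat.exists_eq_succ_of_ne_zero hj.ne'
  rw [Finset.sum_range_succ'] at h1
  simp only [map_smul, smul_eq_mul, zero_add, Nat.choose_one_right, pow_one, LinearMap.sub_apply,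
    AlgHom.toLinearMap_apply, Module.End.one_apply, map_sub, hx0, sub_zero] at h1
  rw [eq_neg_of_add_eq_zero_right h1, dvd_neg]
  refine Finset.dvd_sum fun i hi => ?_
  obtain ⟨w, hw, h2, h3⟩ := hc (i + 1) (by simpa using hi) (Nat.succ_pos i)
  have h4 := dvd_of_mem_augFiltration_sup (h.pow_sub_one_mem_sup (i + 1) hx)
    (c := c - w) (by omega) (by omega)
  refine (pow_dvd_pow ϖ (show c ≤ w + (c - w) by omega)).trans ?_
  rw [pow_add]
  exact mul_dvd_mul hw h4

theorem comp_eq_of_forall_mem_ker {ε' : A →ₐ[R] R} (h : ∀ x ∈ RingHom.ker ε, ε' x = 0) :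
    ε' = ε := by
  ext x
  have := h _ (sub_algebraMap_mem_ker (ε := ε) x)
  rw [map_sub, AlgHom.commutes, sub_eq_zero] at this
  simpa using this

theorem IsContraction.of_dvd (h : IsContraction ϖ ε τ a b)
    (hd : ∀ x ∈ RingHom.ker ε, ϖ ^ a' ∣ ε (τ x)) : IsContraction ϖ ε τ a' b := fun x hx =>
  mem_augFiltration_of_dvd (h x hx) (by
    rw [map_sub, show ε x = 0 from hx, sub_zero]
    exact hd x hx)

theorem IsContraction.dvd (h : IsContraction ϖ ε τ a b) {x : A} (hx : x ∈ RingHom.ker ε) :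
    ϖ ^ a ∣ ε (τ x) := by
  have := dvd_of_mem_augFiltration (h x hx)
  rwa [map_sub, show ε x = 0 from hx, sub_zero] at this

theorem IsContraction.pow (h : IsContraction ϖ ε τ 1 1) (j : ℕ) :
    IsContraction ϖ ε (τ ^ j) 1 1 := by
  intro x hx
  rw [pow_apply_eq_sum]
  refine sum_mem fun i _ => Submodule.smul_mem _ _ ?_
  exact sup_le (augFiltration_mono (by omega) (by omega))
    (augFiltration_mono (by omega) (by omega)) (h.pow_sub_one_mem_sup i hx)

/-- Iterate `pow_prime`. For odd `p` both `a` and `2 * b` double. For `p = 2` the recursion `a' = a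
+ b`, `b' = a` produces Fibonacci numbers. Growth is only guaranteed up to `w + 1`, which is all a
contradiction with `v(p) = w` needs. -/
theorem IsContraction.exists_pow_prime_pow (h : IsContraction ϖ ε τ 1 1) {p w : ℕ} (hp : p.Prime)
    (hw0 : 0 < w) (hw : ϖ ^ w ∣ (p : R)) (i : ℕ) :
    ∃ a b, IsContraction ϖ ε (τ ^ p ^ i) a b ∧ 0 < a ∧ 0 < b ∧
      (p ≠ 2 → min (2 ^ i) (w + 1) ≤ a ∧ min (2 ^ i) (w + 1) ≤ 2 * b) ∧
      (p = 2 → min (Nat.fib (i + 2)) (w + 1) ≤ a ∧ min (Nat.fib (i + 1)) (w + 1) ≤ b) := by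
  induction i with
  | zero => exact ⟨1, 1, by simpa using h, by simp, by simp, by simp, by simp⟩
  | succ i ih =>
    obtain ⟨a, b, hab, ha, hb, h1, h2⟩ := ih
    refine ⟨min (a + w) (min (a + (p - 1) * b) (2 * a)), min (b + w) (min (p * b) a), ?_, ?_, ?_,
      fun hp2 => ?_, fun hp2 => ?_⟩
    · rw [pow_succ, pow_mul]
      exact hab.pow_prime hp hw (by simp) (by simp) (by simp) (by simp) (by simp) (by simp)
    · simp only [lt_min_iff]; omega
    · simp only [lt_min_iff]
      exact ⟨by omega, Nat.mul_pos hp.pos hb, ha⟩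
    · obtain ⟨h3, h4⟩ := h1 hp2
      have hp3 : 3 ≤ p := by have := hp.two_le; omega
      have h5 : 2 * b ≤ (p - 1) * b := Nat.mul_le_mul_right _ (by omega)
      have h6 : 3 * b ≤ p * b := Nat.mul_le_mul_right _ (by omega)
      rw [pow_succ]
      omega
    · obtain ⟨h3, h4⟩ := h2 hp2
      have h5 : Nat.fib (i + 1 + 2) = Nat.fib (i + 1) + Nat.fib (i + 2) := Nat.fib_add_two
      have h6 : Nat.fib (i + 2) = Nat.fib i + Nat.fib (i + 1) := Nat.fib_add_two
      have h7 : Nat.fib i ≤ Nat.fib (i + 1) := Nat.fib_le_fib_succ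
      subst hp2
      rw [show i + 1 + 1 = i + 2 from rfl]
      omega

theorem iterate_comp (τ : A →ₐ[R] A) (ε : A →ₐ[R] R) (j : ℕ) :
    (fun η : A →ₐ[R] R => η.comp τ)^[j] ε = ε.comp (τ ^ j) := by
  induction j with
  | zero => rfl
  | succ j ih => rw [Function.iterate_succ_apply', ih, pow_succ]; rfl

variable [IsDomain R] [IsDiscreteValuationRing R]

/-- The values `ε(τ x)` are not all zero, and a nonzero element of `R` is divisible by only finitely
many powers of `ϖ`; take the largest exponent that divides them all. -/
theorem IsContraction.exists_sharp (hϖ : Irreducible ϖ) (h : IsContraction ϖ ε τ a b)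
    (hne : ε.comp τ ≠ ε) :
    ∃ a', a ≤ a' ∧ IsContraction ϖ ε τ a' b ∧ ∃ x ∈ RingHom.ker ε, ¬ ϖ ^ (a' + 1) ∣ ε (τ x) := by
  classical
  have hex : ∃ n, ∃ x ∈ RingHom.ker ε, ¬ ϖ ^ n ∣ ε (τ x) := by
    by_contra! hcon
    refine hne (comp_eq_of_forall_mem_ker fun x hx => ?_)
    by_contra h0
    obtain ⟨n, hn⟩ := (FiniteMultiplicity.of_not_isUnit hϖ.not_isUnit h0)
    exact hn (hcon (n + 1) x hx)
  set n := Nat.find hex with hn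
  have han : a < n := by
    rw [hn, Nat.lt_find_iff]
    rintro m hm ⟨x, hx, hnd⟩
    exact hnd ((pow_dvd_pow _ hm).trans (h.dvd hx))
  refine ⟨n - 1, by omega, h.of_dvd fun x hx => ?_, ?_⟩
  · by_contra hnd
    exact Nat.find_min hex (m := n - 1) (by omega) ⟨x, hx, hnd⟩
  · rw [Nat.sub_add_cancel (by omega)]
    exact Nat.find_spec hex

/-- With the sharp exponent `a'`, the higher binomial terms are divisible by `ϖ^(a' + 1)`, hence so
is the linear term `s ε(τ x)`. As `s` is a unit, this contradicts sharpness. -/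
theorem IsContraction.comp_eq_of_isUnit (hϖ : Irreducible ϖ) (h : IsContraction ϖ ε τ 1 1) {s : ℕ}
    (hs : IsUnit (s : R)) (hfix : ε.comp (τ ^ s) = ε) : ε.comp τ = ε := by
  by_contra hne
  obtain ⟨a', ha', h', x, hx, hnd⟩ := h.exists_sharp hϖ hne
  have hs0 : 0 < s := Nat.pos_of_ne_zero (by rintro rfl; simp at hs)
  refine hnd ?_
  have := h'.dvd_natCast_mul (c := a' + 1) hs0 hfix
    (fun i _ hi => ⟨0, by simp, by nlinarith, by omega⟩) hx
  exact hs.dvd_mul_left.mp this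

/-- For a suitable `x` the linear term `p ε(τ x)` has valuation exactly `w + a'`, where `a'` is
sharp. If `w` were below both `(p - 1) * b` and `a`, every other term would have larger valuation
and the sum could not vanish. -/
theorem IsContraction.le_of_comp_pow_eq (hϖ : Irreducible ϖ) (h : IsContraction ϖ ε τ a b)
    (hb : 0 < b) {p w : ℕ} (hp : p.Prime) (hw : Associated (p : R) (ϖ ^ w))
    (hne : ε.comp τ ≠ ε) (hfix : ε.comp (τ ^ p) = ε) : min ((p - 1) * b) a ≤ w := by
  obtain ⟨a', ha', h', x, hx, hnd⟩ := h.exists_sharp hϖ hne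
  by_contra! hlt
  obtain ⟨h1, h2⟩ := lt_min_iff.mp hlt
  have := h'.dvd_natCast_mul (c := w + (a' + 1)) hp.pos hfix (fun i hi hi0 => by
    rcases (Nat.succ_le_of_lt hi).lt_or_eq with hlt | heq
    · exact ⟨w, hw.symm.dvd.trans
        (Nat.cast_dvd_cast (hp.dvd_choose_self (Nat.succ_ne_zero i) hlt)), by nlinarith, by omega⟩
    · refine ⟨0, by simp, ?_, by omega⟩
      have : i = p - 1 := by omega
      rw [this]
      omega) hx
  rw [(hw.mul_right _).dvd_iff_dvd_right, pow_add] at this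
  exact hnd ((mul_dvd_mul_iff_left (pow_ne_zero _ hϖ.ne_zero)).mp this)

theorem goldenRatio_pow_le_fib (e : ℕ) : Real.goldenRatio ^ e ≤ Nat.fib (e + 2) := by
  induction e using Nat.twoStepInduction with
  | zero => simp
  | one => simpa [Nat.fib] using Real.goldenRatio_lt_two.le
  | more e h1 h2 =>
    rw [Nat.fib_add_two, pow_add, Real.goldenRatio_sq]
    push_cast
    rw [show e + 1 + 2 = e + 2 + 1 by ring] at h2
    rw [mul_add, ← pow_succ, mul_one]
    linarith

theorem exponentBound_zero (p : ℕ) {v : ℕ} (hv : 0 < v) : ExponentBound p v 0 := by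
  have hv1 : (1 : ℝ) ≤ v := by exact_mod_cast hv
  refine ⟨fun _ => ?_, fun _ => ?_⟩
  · have := Real.logb_nonneg one_lt_two hv1
    simp only [Nat.cast_zero]
    linarith
  · have h5 : (1 : ℝ) ≤ √5 := Real.one_le_sqrt.mpr (by norm_num)
    have h6 : (1 : ℝ) ≤ √(5 * (v : ℝ) ^ 2 + 4) := Real.one_le_sqrt.mpr (by nlinarith)
    have := Real.logb_nonneg Real.one_lt_goldenRatio
      (show 1 ≤ (√5 * v + √(5 * (v : ℝ) ^ 2 + 4)) / 2 by nlinarith)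
    simp only [Nat.cast_zero]
    linarith

/-- For `p = 2`, the golden ratio is at most `√5` and its `e`-th power is at most `Nat.fib (e + 2)`.
So its `e`-th power is at most `√5 v`, which is below the average of `√5 v` and `√(5v² + 4)`. -/
theorem exponentBound_succ {p v e : ℕ} (h : p ≠ 2 → 2 ^ e ≤ v)
    (h2 : p = 2 → Nat.fib (e + 1) ≤ v) : ExponentBound p v (e + 1) := by
  refine ⟨fun hp => ?_, fun hp => ?_⟩
  · have h1 : (2 : ℝ) ^ (e : ℝ) ≤ v := by rw [Real.rpow_natCast]; exact_mod_cast h hp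
    have := (Real.le_logb_iff_rpow_le one_lt_two (lt_of_lt_of_le (by positivity) h1)).mpr h1
    push_cast
    linarith
  · have hv : (Nat.fib (e + 1) : ℝ) ≤ v := by exact_mod_cast h2 hp
    have hφ : Real.goldenRatio ≤ √5 := by
      have : (1 : ℝ) ≤ √5 := Real.one_le_sqrt.mpr (by norm_num)
      unfold Real.goldenRatio
      linarith
    have h1 : Real.goldenRatio ^ e ≤ √5 * v := by
      cases e with
      | zero =>
        have : (1 : ℝ) ≤ √5 := Real.one_le_sqrt.mpr (by norm_num)
        simp only [zero_add, Nat.fib_one, Nat.cast_one] at hv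
        simpa using one_le_mul_of_one_le_of_one_le this hv
      | succ e =>
        rw [pow_succ']
        exact mul_le_mul hφ ((goldenRatio_pow_le_fib e).trans hv)
          (pow_nonneg Real.goldenRatio_pos.le _) (Real.sqrt_nonneg _)
    have h3 : √5 * v ≤ √(5 * (v : ℝ) ^ 2 + 4) := by
      refine Real.le_sqrt_of_sq_le ?_
      rw [mul_pow, Real.sq_sqrt (by norm_num)]
      linarith
    have h4 : Real.goldenRatio ^ (e : ℝ) ≤ (√5 * v + √(5 * (v : ℝ) ^ 2 + 4)) / 2 := by
      rw [Real.rpow_natCast]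
      linarith
    have := (Real.le_logb_iff_rpow_le Real.one_lt_goldenRatio
      (lt_of_lt_of_le (by have := Real.goldenRatio_pos; positivity) h4)).mpr h4
    push_cast
    linarith

/-- The period of a section under an endomorphism which is the identity to first order modulo the
uniformizer is a power of the residue characteristic, with bounded exponent. -/
theorem IsContraction.minimalPeriod_eq (hϖ : Irreducible ϖ) (h : IsContraction ϖ ε τ 1 1) {p : ℕ}
    (hp : p.Prime) (hpϖ : ϖ ∣ (p : R))
    (hpos : 0 < Function.minimalPeriod (fun η : A →ₐ[R] R => η.comp τ) ε) :
    ∃ e, Function.minimalPeriod (fun η : A →ₐ[R] R => η.comp τ) ε = p ^ e ∧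
      ∀ v : ℕ, IsDiscreteValuationRing.addVal R (p : R) = v → ExponentBound p v e := by
  set N := Function.minimalPeriod (fun η : A →ₐ[R] R => η.comp τ) ε with hN
  have hfix (j : ℕ) : N ∣ j ↔ ε.comp (τ ^ j) = ε := by
    rw [hN, ← Function.isPeriodicPt_iff_minimalPeriod_dvd, Function.IsPeriodicPt,
      Function.IsFixedPt, iterate_comp]
  obtain ⟨e, s, hs, hNe⟩ := Nat.exists_eq_pow_mul_and_not_dvd hpos.ne' p hp.ne_one
  -- `p` lies in the maximal ideal and is coprime to `s`; if `s` were in it too, a Bézout relation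
  -- would put `1` there.
  have hsu : IsUnit (s : R) := by
    by_contra hnu
    have h1 : (s : R) ∈ IsLocalRing.maximalIdeal R := hnu
    have h2 : (p : R) ∈ IsLocalRing.maximalIdeal R := fun hu =>
      hϖ.not_isUnit (isUnit_of_dvd_unit hpϖ hu)
    have hco := Nat.isCoprime_iff_coprime.mpr ((hp.coprime_iff_not_dvd).mpr hs)
    obtain ⟨x, y, hxy⟩ := hco.map (Int.castRingHom R)
    refine (Ideal.ne_top_iff_one _).mp (IsLocalRing.maximalIdeal.isMaximal R).ne_top ?_
    rw [← hxy]
    exact add_mem (Ideal.mul_mem_left _ _ (by simpa using h2))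
      (Ideal.mul_mem_left _ _ (by simpa using h1))
  have hNe' : N = p ^ e := by
    refine Nat.dvd_antisymm ?_ ⟨s, hNe⟩
    rw [hfix]
    refine (h.pow (p ^ e)).comp_eq_of_isUnit hϖ hsu ?_
    rw [← pow_mul, ← hNe]
    exact (hfix N).mp dvd_rfl
  refine ⟨e, hNe', fun v hv => ?_⟩
  have hass : Associated (p : R) (ϖ ^ v) := by
    have h0 : (p : R) ≠ 0 := by
      intro h0
      rw [h0, IsDiscreteValuationRing.addVal_zero] at hv
      exact absurd hv (by simp)
    obtain ⟨n, u, hu⟩ := IsDiscreteValuationRing.eq_unit_mul_pow_irreducible h0 hϖ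
    rw [hu, IsDiscreteValuationRing.addVal_def' u hϖ] at hv
    have hnv : n = v := by exact_mod_cast hv
    rw [hu, hnv]
    exact associated_unit_mul_left _ _ u.isUnit
  have hv0 : 0 < v := by
    rw [Nat.pos_iff_ne_zero]
    rintro rfl
    rw [pow_zero, associated_one_iff_isUnit] at hass
    exact hϖ.not_isUnit (isUnit_of_dvd_unit hpϖ hass)
  cases e with
  | zero => exact exponentBound_zero p hv0
  | succ e =>
    obtain ⟨a, b, hab, ha, hb, h1, h2⟩ := h.exists_pow_prime_pow hp hv0 hass.symm.dvd e
    -- The period is `p ^ (e + 1)`, so `τ ^ p ^ e` still moves `ε` while its `p`-th power fixes it.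
    have hmin := hab.le_of_comp_pow_eq hϖ hb hp hass
      (fun heq => by
        have := Nat.le_of_dvd (pow_pos hp.pos _) ((hfix _).mpr heq)
        rw [hNe', pow_succ] at this
        have := hp.two_le
        have := pow_pos hp.pos e
        nlinarith)
      (by rw [← pow_mul, ← pow_succ, ← hNe']; exact (hfix N).mp dvd_rfl)
    refine exponentBound_succ (fun hp2 => ?_) fun hp2 => ?_
    · obtain ⟨h3, h4⟩ := h1 hp2
      have hp3 : 3 ≤ p := by have := hp.two_le; omega
      have h5 : 2 * b ≤ (p - 1) * b := Nat.mul_le_mul_right _ (by omega)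
      omega
    · obtain ⟨h3, h4⟩ := h2 hp2
      have h5 : Nat.fib (e + 1) ≤ Nat.fib (e + 2) := Nat.fib_le_fib_succ
      subst hp2
      omega

end Contraction

/-! ### Orders and self-duality of endomorphisms of finite-dimensional spaces. -/

section LinearAlgebra

open Polynomial

/-- Over a finite field with `q` elements, the order of an endomorphism of a nonzero space of
dimension `d` is at most `q ^ d - 1`. -/
theorem orderOf_end_le {k V : Type*} [Field k] [Finite k] [AddCommGroup V] [Module k V]
    [FiniteDimensional k V] [Nontrivial V] (h : Module.End k V) :
    orderOf h ≤ Nat.card k ^ Module.finrank k V - 1 := by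
  classical
  rcases Nat.eq_zero_or_pos (orderOf h) with h0 | h0
  -- An endomorphism without a positive power equal to `1` has `orderOf` equal to `0`.
  · simp [h0]
  have hu : IsUnit h := (orderOf_pos_iff.mp h0).isUnit
  set d := Module.finrank k V
  have hχ := h.charpoly_monic
  have hmem (i : ℕ) : (X ^ i %ₘ h.charpoly : k[X]) ∈ degreeLT k d := by
    rw [mem_degreeLT]
    refine (degree_modByMonic_lt _ hχ).trans_eq ?_
    rw [degree_eq_natDegree hχ.ne_zero, h.charpoly_natDegree]
  have haeval (i : ℕ) : aeval h (X ^ i %ₘ h.charpoly : k[X]) = h ^ i := by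
    rw [modByMonic_eq_sub_mul_div _ _, map_sub, map_mul, h.aeval_self_charpoly]
    simp
  have : Finite (degreeLT k d) := Finite.of_equiv _ (degreeLTEquiv k d).toEquiv.symm
  -- Powers below the order are distinct and nonzero, and each is recovered from the remainder of `X
  -- ^ i` modulo the characteristic polynomial. There are only `q ^ d - 1` nonzero polynomials of
  -- degree less than `d`.
  have hinj : Function.Injective (fun i : Fin (orderOf h) =>
      (⟨⟨_, hmem i⟩, fun hz => by
        have h1 := haeval i
        rw [show (X ^ (i : ℕ) %ₘ h.charpoly : k[X]) = 0 from congrArg Subtype.val hz, map_zero] at h1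
        exact (hu.pow (i : ℕ)).ne_zero h1.symm⟩ : {x : degreeLT k d // x ≠ 0})) := by
    intro i j hij
    have h1 : (X ^ (i : ℕ) %ₘ h.charpoly : k[X]) = X ^ (j : ℕ) %ₘ h.charpoly :=
      congrArg (fun x : {x : degreeLT k d // x ≠ 0} => (x.1 : k[X])) hij
    have h2 : h ^ (i : ℕ) = h ^ (j : ℕ) := by rw [← haeval, h1, haeval]
    exact Fin.ext (pow_injOn_Iio_orderOf i.2 j.2 h2)
  have hcard := Nat.card_le_card_of_injective _ hinj
  have h3 : Nat.card {x : degreeLT k d // x ≠ 0} = Nat.card (degreeLT k d) - 1 := by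
    have := Fintype.ofFinite (degreeLT k d)
    rw [Nat.card_eq_fintype_card, Nat.card_eq_fintype_card, Fintype.card_subtype_compl]
    simp
  rw [h3, Nat.card_congr (degreeLTEquiv k d).toEquiv, Nat.card_fun] at hcard
  simpa using hcard

/-- `k[X]/(g)` is a Frobenius algebra: take the coefficient of `X ^ (deg g - 1)` in the reduced
representative. Multiplying a nonzero remainder by a suitable power of `X` moves its leading
coefficient there without any further reduction. -/
theorem exists_functional_of_monic {k : Type*} [Field k] {g : k[X]} (hg : g.Monic) :
    ∃ l : (k[X] ⧸ Ideal.span {g}) →ₗ[k] k, ∀ x, (∀ y, l (x * y) = 0) → x = 0 := by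
  obtain ⟨s, hs⟩ := (Ideal.Quotient.mkₐ k (Ideal.span {g})).toLinearMap.exists_rightInverse_of_surjective
    (LinearMap.range_eq_top.mpr (Ideal.Quotient.mkₐ_surjective k _))
  refine ⟨(lcoeff k (g.natDegree - 1)) ∘ₗ (modByMonicHom g) ∘ₗ s, fun x hx => ?_⟩
  have hl (r : k[X]) : modByMonicHom g (s (Ideal.Quotient.mk _ r)) = r %ₘ g := by
    have h1 : Ideal.Quotient.mk (Ideal.span {g}) (s (Ideal.Quotient.mk _ r)) =
      Ideal.Quotient.mk _ r := LinearMap.congr_fun hs _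
    rw [Ideal.Quotient.eq, Ideal.mem_span_singleton] at h1
    rw [← (modByMonic_eq_zero_iff_dvd hg), sub_modByMonic, sub_eq_zero] at h1
    exact h1
  obtain ⟨r, rfl⟩ := Ideal.Quotient.mk_surjective x
  by_contra hne
  set t := r %ₘ g with ht
  have ht0 : t ≠ 0 := by
    rw [ht, Ne, modByMonic_eq_zero_iff_dvd hg, ← Ideal.mem_span_singleton,
      ← Ideal.Quotient.eq_zero_iff_mem]
    exact hne
  have hdeg : t.natDegree < g.natDegree :=
    natDegree_lt_natDegree ht0 (degree_modByMonic_lt _ hg)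
  have h1 := hx (Ideal.Quotient.mk _ (X ^ (g.natDegree - 1 - t.natDegree)))
  rw [← map_mul, LinearMap.comp_apply, LinearMap.comp_apply, hl, lcoeff_apply] at h1
  set a := g.natDegree - 1 - t.natDegree with ha
  have h2 : r * X ^ a %ₘ g = t * X ^ a %ₘ g := by
    rw [← sub_eq_zero, ← sub_modByMonic, modByMonic_eq_zero_iff_dvd hg, ← sub_mul]
    refine Dvd.dvd.mul_right ⟨r /ₘ g, ?_⟩ _
    rw [sub_eq_iff_eq_add', ht, modByMonic_add_div]
  have h3 : t * X ^ a %ₘ g = t * X ^ a := by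
    rw [modByMonic_eq_self_iff hg, degree_eq_natDegree hg.ne_zero,
      degree_eq_natDegree (mul_ne_zero ht0 (pow_ne_zero _ X_ne_zero)),
      natDegree_mul_X_pow _ ht0]
    exact_mod_cast (by omega : t.natDegree + a < g.natDegree)
  rw [h2, h3, show g.natDegree - 1 = t.natDegree + a by omega, coeff_mul_X_pow,
    coeff_natDegree, leadingCoeff_eq_zero] at h1
  exact ht0 h1

/-- A finite-dimensional space with an endomorphism is isomorphic to its dual with the transposed
endomorphism. -/
theorem exists_equiv_dual {k V : Type*} [Field k] [AddCommGroup V] [Module k V]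
    [FiniteDimensional k V] (h : Module.End k V) :
    ∃ B : V ≃ₗ[k] Module.Dual k V, ∀ x y, B (h x) y = B x (h y) := by
  classical
  obtain ⟨ι, _, p, hp, e, ⟨E⟩⟩ := Module.equiv_directSum_of_isTorsion
    (Module.AEval.isTorsion_of_finiteDimensional k V h)
  have hfun (i : ι) : ∃ l : (k[X] ⧸ Ideal.span {p i ^ e i}) →ₗ[k] k,
      ∀ x, (∀ y, l (x * y) = 0) → x = 0 := by
    have h0 : p i ^ e i ≠ 0 := pow_ne_zero _ (hp i).ne_zero
    rw [← Ideal.span_singleton_mul_right_unit (isUnit_C.mpr (isUnit_iff_ne_zero.mpr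
      (inv_ne_zero (leadingCoeff_ne_zero.mpr h0))))]
    exact exists_functional_of_monic (monic_mul_leadingCoeff_inv h0)
  choose l hl using hfun
  let F : V → (i : ι) → (k[X] ⧸ Ideal.span {p i ^ e i}) := fun v i => E (Module.AEval.of k V h v) i
  have hFadd (x y i) : F (x + y) i = F x i + F y i := by simp [F]
  have hFsmul (c : k) (x i) : F (c • x) i = c • F x i := by
    simp only [F, map_smul]
    rw [← Module.AEval.C_smul, map_smul, DirectSum.smul_apply]
    exact (algebraMap_smul k[X] c (E (Module.AEval.of k V h x) i))
  have hFX (x i) : F (h x) i = Ideal.Quotient.mk _ X * F x i := by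
    simp only [F]
    have h1 : Module.AEval.of k V h (h x) = (X : k[X]) • Module.AEval.of k V h x :=
      (Module.AEval.X_smul_of h x).symm
    rw [h1, map_smul, DirectSum.smul_apply]
    rfl
  -- Decompose `V` into cyclic modules `k[X]/(p_i ^ e_i)` and add their Frobenius forms. Since `h`
  -- is multiplication by `X`, it moves across the product and is self-adjoint.
  let B0 : V →ₗ[k] Module.Dual k V := LinearMap.mk₂ k (fun x y => ∑ i, l i (F x i * F y i))
    (fun x x' y => by simp [hFadd, add_mul, Finset.sum_add_distrib])
    (fun c x y => by
      rw [smul_eq_mul, Finset.mul_sum]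
      exact Finset.sum_congr rfl fun i _ => by
        rw [hFsmul, smul_mul_assoc, map_smul, smul_eq_mul])
    (fun x x' y => by simp [hFadd, mul_add, Finset.sum_add_distrib])
    (fun c x y => by
      rw [smul_eq_mul, Finset.mul_sum]
      exact Finset.sum_congr rfl fun i _ => by
        rw [hFsmul, mul_smul_comm, map_smul, smul_eq_mul])
  have hB0 (x y) : B0 x y = ∑ i, l i (F x i * F y i) := rfl
  have hinj : Function.Injective B0 := by
    rw [injective_iff_map_eq_zero]
    intro x hx
    have h1 (i) : F x i = 0 := by
      refine hl i _ fun y => ?_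
      have h2 := LinearMap.congr_fun hx ((Module.AEval.of k V h).symm (E.symm (DirectSum.of _ i y)))
      rw [hB0, Finset.sum_eq_single i] at h2
      · simpa [F] using h2
      · intro j _ hj
        simp [F, DirectSum.of_eq_of_ne _ _ _ hj]
      · simp
    have h3 : E (Module.AEval.of k V h x) = 0 := by
      ext i
      exact h1 i
    simpa using h3
  refine ⟨LinearEquiv.ofInjectiveOfFinrankEq B0 hinj Subspace.dual_finrank_eq.symm, fun x y => ?_⟩
  change B0 (h x) y = B0 x (h y)
  simp only [hB0, hFX]
  exact Finset.sum_congr rfl fun i _ => by rw [mul_assoc, mul_left_comm]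

/-- A quotient of a finite-dimensional space with an endomorphism is isomorphic to a stable
subspace. -/
theorem exists_submodule_equiv_of_surjective {k M V : Type*} [Field k] [AddCommGroup M]
    [Module k M] [FiniteDimensional k M] [AddCommGroup V] [Module k V] (g : Module.End k M)
    (h : Module.End k V) (π : M →ₗ[k] V) (hπ : Function.Surjective π)
    (hc : ∀ x, π (g x) = h (π x)) :
    ∃ (W : Submodule k M) (hW : ∀ w ∈ W, g w ∈ W) (ι : W ≃ₗ[k] V),
      ∀ w, ι (g.restrict hW w) = h (ι w) := by
  have : FiniteDimensional k V := Module.Finite.of_surjective π hπ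
  obtain ⟨B, hB⟩ := exists_equiv_dual g
  obtain ⟨C, hC⟩ := exists_equiv_dual h
  -- The transpose of the surjection `π` is injective; the self-dualities of `V` and `M` turn it
  -- into an equivariant embedding of `V` in `M`.
  let j : V →ₗ[k] M := B.symm.toLinearMap ∘ₗ π.dualMap ∘ₗ C.toLinearMap
  have hjB (v : V) (x : M) : B (j v) x = C v (π x) := by simp [j]
  have hj (v : V) : g (j v) = j (h v) := by
    apply B.injective
    ext x
    rw [hB, hjB, hjB, hc, hC]
  have hjinj : Function.Injective j := by
    exact B.symm.injective.comp
      ((LinearMap.dualMap_injective_of_surjective hπ).comp C.injective)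
  refine ⟨LinearMap.range j, ?_, (LinearEquiv.ofInjective j hjinj).symm, fun w => ?_⟩
  · rintro _ ⟨v, rfl⟩
    exact ⟨h v, (hj v).symm⟩
  · obtain ⟨v, rfl⟩ := (LinearEquiv.ofInjective j hjinj).surjective w
    rw [LinearEquiv.symm_apply_apply, LinearEquiv.symm_apply_eq]
    exact Subtype.ext (hj v)

end LinearAlgebra

/-! ### Descent of smoothness along faithfully flat étale algebras. -/

section SmoothDescent

open TensorProduct Polynomial

/-- Standard étale algebras lift along surjections. -/
theorem exists_etale_lift {P S T : Type u} [CommRing P] [CommRing S] [CommRing T] [Algebra P S]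
    (hPS : Function.Surjective (algebraMap P S)) [Algebra S T] [Algebra.IsStandardEtale S T] :
    ∃ (Q : Type u) (_ : CommRing Q) (_ : Algebra P Q), Algebra.Etale P Q ∧
      Nonempty (T ≃ₐ[S] S ⊗[P] Q) := by
  obtain ⟨E⟩ := Algebra.IsStandardEtale.nonempty_standardEtalePresentation (R := S) (S := T)
  obtain ⟨f, hf, -, hfm⟩ := lifts_and_natDegree_eq_and_monic
    (mem_lifts_of_surjective hPS E.f) E.monic_f
  obtain ⟨g, hg⟩ := map_surjective _ hPS E.g
  -- Inverting the derivative as well makes any lift of the equation étale, and changes nothing over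
  -- `S`, where the derivative is already invertible in `T`.
  let D : StandardEtalePair P := ⟨f, hfm, g * derivative f, g, 0, 1, by ring⟩
  refine ⟨D.Ring, inferInstance, inferInstance, inferInstance, ⟨?_⟩⟩
  algebraize [(algebraMap S T).comp (algebraMap P S)]
  have hDx : D.HasMap E.x := by
    have h1 := E.hasMap.1
    have h2 := E.hasMap.2
    have h3 := E.hasMap.isUnit_derivative_f
    rw [← hf, aeval_map_algebraMap] at h1
    rw [← hg, aeval_map_algebraMap] at h2
    rw [← hf, derivative_map, aeval_map_algebraMap] at h3
    exact ⟨h1, by simpa [D] using h2.mul h3⟩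
  have hEX : E.HasMap (1 ⊗ₜ[P] D.X : S ⊗[P] D.Ring) := by
    have h := (D.hasMap_X).map (Algebra.TensorProduct.includeRight (R := P) (A := S))
    refine ⟨?_, ?_⟩
    · rw [← hf, aeval_map_algebraMap]
      exact h.1
    · rw [← hg, aeval_map_algebraMap]
      have h2 := h.2
      simp only [D, map_mul] at h2
      exact isUnit_of_mul_isUnit_left h2
  let a : S ⊗[P] D.Ring →ₐ[S] T :=
    Algebra.TensorProduct.lift (Algebra.ofId S T) (D.lift E.x hDx) fun _ _ => .all _ _
  refine AlgEquiv.ofAlgHom ((E.lift _ hEX).comp E.equivRing.toAlgHom) a ?_ ?_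
  · apply Algebra.TensorProduct.ext
    · ext
    · apply D.hom_ext
      simp [a]
  · apply E.hom_ext
    simp [a]

theorem liftBaseChange_ideal_bijective {P Q : Type u} [CommRing P] [CommRing Q] [Algebra P Q]
    [Module.Flat P Q] {I : Ideal P} {J : Ideal Q} (hJ : J = I.map (algebraMap P Q))
    (m : I →ₗ[P] J) (hm : ∀ x, (m x : Q) = algebraMap P Q x) :
    Function.Bijective (m.liftBaseChange Q) := by
  constructor
  · have h1 : Function.Injective (I.subtype.lTensor Q) :=
      Module.Flat.lTensor_preserves_injective_linearMap _ I.injective_subtype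
    have h2 (z : Q ⊗[P] I) : ((m.liftBaseChange Q z : J) : Q) =
        TensorProduct.rid P Q (I.subtype.lTensor Q z) := by
      induction z with
      | zero => simp
      | add x y hx hy => simp [hx, hy]
      | tmul q x => simp [hm, Algebra.smul_def, mul_comm]
    intro x y hxy
    apply h1
    apply (TensorProduct.rid P Q).injective
    rw [← h2, ← h2, hxy]
  · rintro ⟨x, hx⟩
    have hx' := hx
    rw [hJ, Ideal.map] at hx'
    refine Submodule.span_induction (p := fun y _ => ∀ hy : y ∈ J,
      ∃ z, m.liftBaseChange Q z = ⟨y, hy⟩) ?_ ?_ ?_ ?_ hx' hx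
    · rintro _ ⟨y, hy, rfl⟩ h
      exact ⟨1 ⊗ₜ ⟨y, hy⟩, Subtype.ext (by simp [hm])⟩
    · exact fun h => ⟨0, by rw [map_zero]; rfl⟩
    · intro a b ha hb iha ihb h
      obtain ⟨z, hz⟩ := iha (hJ.ge ha)
      obtain ⟨w, hw⟩ := ihb (hJ.ge hb)
      exact ⟨z + w, by rw [map_add, hz, hw]; rfl⟩
    · intro c a ha iha h
      obtain ⟨z, hz⟩ := iha (hJ.ge ha)
      exact ⟨c • z, by rw [map_smul, hz]; rfl⟩

theorem ker_includeRight_of_surjective {P S Q : Type u} [CommRing P] [CommRing S] [CommRing Q]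
    [Algebra P S] [Algebra P Q] (hPS : Function.Surjective (algebraMap P S)) :
    RingHom.ker (Algebra.TensorProduct.includeRight : Q →ₐ[P] S ⊗[P] Q) =
      (RingHom.ker (algebraMap P S)).map (algebraMap P Q) := by
  have h1 := Algebra.TensorProduct.rTensor_ker (R := P) (S := P) (C := Q) (Algebra.ofId P S) hPS
  apply le_antisymm
  · intro q hq
    have h2 : (1 ⊗ₜ q : P ⊗[P] Q) ∈
        RingHom.ker (Algebra.TensorProduct.map (Algebra.ofId P S) (AlgHom.id P Q)) := by
      rw [RingHom.mem_ker, Algebra.TensorProduct.map_tmul, map_one]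
      exact hq
    rw [h1] at h2
    have h3 := Ideal.mem_map_of_mem (Algebra.TensorProduct.lid P Q : P ⊗[P] Q →ₐ[P] Q) h2
    rw [Ideal.map_mapₐ, Subsingleton.elim ((Algebra.TensorProduct.lid P Q : P ⊗[P] Q →ₐ[P] Q).comp
      Algebra.TensorProduct.includeLeft) (Algebra.ofId P Q)] at h3
    have h5 : (Algebra.TensorProduct.lid P Q : P ⊗[P] Q →ₐ[P] Q) (1 ⊗ₜ q) = q := by simp
    rw [h5] at h3
    exact h3
  · rw [Ideal.map_le_iff_le_comap]
    intro x hx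
    have hx' : algebraMap P S x = 0 := hx
    rw [Ideal.mem_comap, RingHom.mem_ker, AlgHom.commutes, Algebra.TensorProduct.algebraMap_apply,
      hx', TensorProduct.zero_tmul]

/-- `P` and `E` have formally smooth rings over `R`, so they compute the first cotangent homology of
`S` and `T`. As `E` arises from `P` by an étale map with compatible kernels, the second homology is
the base change of the first along `S → T`, and faithful flatness reflects its vanishing. -/
theorem subsingleton_h1Cotangent_of_hom {R S T : Type u} [CommRing R] [CommRing S]
    [CommRing T] [Algebra R S] [Algebra R T] [Algebra S T] [IsScalarTower R S T]
    {P : Algebra.Extension.{u} R S} {E : Algebra.Extension.{u} R T} [Algebra.FormallySmooth R P.Ring]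
    (f : P.Hom E) [Algebra P.Ring E.Ring] (hf : algebraMap P.Ring E.Ring = f.toRingHom)
    [Algebra.Etale P.Ring E.Ring] (hker : E.ker = P.ker.map (algebraMap P.Ring E.Ring))
    [Module.FaithfullyFlat S T] [Subsingleton (Algebra.H1Cotangent R T)] :
    Subsingleton (Algebra.H1Cotangent R S) := by
  have : IsScalarTower R P.Ring E.Ring := .of_algebraMap_eq fun r => by
    rw [hf]
    exact (f.toRingHom_algebraMap r).symm
  have hfe : f.toRingHom.FormallyEtale := by
    rw [← hf]
    exact RingHom.formallyEtale_algebraMap.mpr inferInstance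
  have : Algebra.FormallySmooth R E.Ring := Algebra.FormallySmooth.comp R P.Ring E.Ring
  have e1 := Algebra.Extension.tensorH1CotangentOfFormallyEtale f hf hfe
    (liftBaseChange_ideal_bijective hker _ fun x => by rw [hf]; rfl)
  have h1 : Subsingleton E.H1Cotangent :=
    (Algebra.Extension.equivH1CotangentOfFormallySmooth E).toEquiv.subsingleton
  have h2 : Subsingleton (T ⊗[S] P.H1Cotangent) := e1.toEquiv.subsingleton
  have h3 : Subsingleton P.H1Cotangent := Module.FaithfullyFlat.lTensor_reflects_triviality S T _
  exact (Algebra.Extension.equivH1CotangentOfFormallySmooth P).symm.toEquiv.subsingleton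

/-- The étale lift `Q` surjects onto `T`, with kernel generated by that of `P → S`; it is the
extension of `T` needed for the comparison. -/
theorem subsingleton_h1Cotangent_of_etale_lift {R S T : Type u} [CommRing R] [CommRing S]
    [CommRing T] [Algebra R S] [Algebra R T] [Algebra S T] [IsScalarTower R S T]
    (P : Algebra.Extension.{u} R S) [Algebra.FormallySmooth R P.Ring] (Q : Type u) [CommRing Q]
    [Algebra P.Ring Q] [Algebra.Etale P.Ring Q] (e : T ≃ₐ[S] S ⊗[P.Ring] Q)
    [Module.FaithfullyFlat S T] [Subsingleton (Algebra.H1Cotangent R T)] :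
    Subsingleton (Algebra.H1Cotangent R S) := by
  let F0 : Q →+* T := (e.symm : S ⊗[P.Ring] Q →+* T).comp
    (Algebra.TensorProduct.includeRight : Q →ₐ[P.Ring] S ⊗[P.Ring] Q).toRingHom
  have hF0 : Function.Surjective F0 := e.symm.surjective.comp
    (Algebra.TensorProduct.includeRight_surjective _ P.algebraMap_surjective)
  have hcomm (x : P.Ring) : F0 (algebraMap P.Ring Q x) = algebraMap S T (algebraMap P.Ring S x) := by
    simp only [F0, AlgHom.toRingHom_eq_coe, RingHom.coe_comp, RingHom.coe_coe, Function.comp_apply,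
      AlgHom.commutes]
    exact e.symm.commutes _
  let E : Algebra.Extension.{u} R T :=
    { Ring := Q
      algebra₁ := ((algebraMap P.Ring Q).comp (algebraMap R P.Ring)).toAlgebra
      algebra₂ := F0.toAlgebra
      isScalarTower := by
        let := ((algebraMap P.Ring Q).comp (algebraMap R P.Ring)).toAlgebra
        let := F0.toAlgebra
        refine .of_algebraMap_eq fun r => ?_
        change _ = F0 (algebraMap P.Ring Q (algebraMap R P.Ring r))
        rw [hcomm, ← IsScalarTower.algebraMap_apply R P.Ring S, ← IsScalarTower.algebraMap_apply]
      σ := fun x => (hF0 x).choose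
      algebraMap_σ := fun x => (hF0 x).choose_spec }
  let alg : Algebra P.Ring E.Ring := ‹Algebra P.Ring Q›
  have : Algebra.Etale P.Ring E.Ring := ‹Algebra.Etale P.Ring Q›
  let f : P.Hom E :=
    { toRingHom := algebraMap P.Ring Q
      toRingHom_algebraMap := fun x => rfl
      algebraMap_toRingHom := fun x => hcomm x }
  refine subsingleton_h1Cotangent_of_hom f rfl ?_
  refine Eq.trans ?_ (ker_includeRight_of_surjective (Q := Q) P.algebraMap_surjective)
  exact RingHom.ker_comp_of_injective _ (e.symm.injective)

/-- Smoothness descends along faithfully flat standard étale algebras. -/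
theorem smooth_of_isStandardEtale {R S T : Type u} [CommRing R] [CommRing S]
    [CommRing T] [Algebra R S] [Algebra R T] [Algebra S T] [IsScalarTower R S T]
    [Algebra.IsStandardEtale S T] [Module.FaithfullyFlat S T] [Algebra.FinitePresentation R S]
    [Algebra.FormallySmooth R T] : Algebra.Smooth R S := by
  have hT := (Algebra.formallySmooth_iff R T).mp inferInstance
  refine ⟨(Algebra.formallySmooth_iff R S).mpr ⟨?_, ?_⟩, inferInstance⟩
  -- The differentials of `S` become those of `T` after base change, so they are flat by descent;
  -- being finitely presented, they are projective.
  · have := hT.1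
    have : Module.Flat T (T ⊗[S] Ω[S⁄R]) := .of_linearEquiv
      (KaehlerDifferential.tensorKaehlerEquivOfFormallyEtale R S T)
    have : Module.Flat S Ω[S⁄R] := Module.Flat.of_flat_tensorProduct _ _ T
    exact Module.Flat.projective_of_finitePresentation
  · have := hT.2
    let P := (Algebra.Generators.self R S).toExtension
    have : Algebra.FormallySmooth R P.Ring :=
      inferInstanceAs (Algebra.FormallySmooth R (MvPolynomial _ R))
    obtain ⟨Q, _, _, _, ⟨e⟩⟩ := exists_etale_lift (T := T) P.algebraMap_surjective
    exact subsingleton_h1Cotangent_of_etale_lift P Q e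

end SmoothDescent

/-! ### Étale images of smooth points. -/

section SmoothLocus

open TensorProduct PrimeSpectrum

/-- The image of `Spec T` is open. Over a basic open subset of it around the given point, the étale
map is surjective, hence faithfully flat, and smoothness descends. -/
theorem comap_mem_smoothLocus_of_isStandardEtale {R A T : Type u} [CommRing R] [CommRing A]
    [CommRing T] [Algebra R A] [Algebra A T] [Algebra R T] [IsScalarTower R A T]
    [Algebra.FinitePresentation R A] [Algebra.IsStandardEtale A T] [Algebra.Smooth R T]
    (t : PrimeSpectrum T) : comap (algebraMap A T) t ∈ Algebra.smoothLocus R A := by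
  have hopen : IsOpenMap (comap (algebraMap A T)) :=
    isOpenMap_comap_of_hasGoingDown_of_finitePresentation
  have hmem : comap (algebraMap A T) t ∈ Set.range (comap (algebraMap A T)) := ⟨t, rfl⟩
  obtain ⟨_, ⟨_, ⟨a, rfl⟩, rfl⟩, ha, haT⟩ := isBasis_basic_opens.exists_subset_of_mem_open hmem
    hopen.isOpen_range
  have hsurj : Function.Surjective (comap (algebraMap (Localization.Away a)
      (Localization.Away a ⊗[A] T))) := by
    intro p
    have hp : comap (algebraMap A (Localization.Away a)) p ∈ (basicOpen a : Set (PrimeSpectrum A)) := by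
      rw [← localization_away_comap_range (Localization.Away a) a]
      exact ⟨p, rfl⟩
    obtain ⟨s, hs⟩ := haT hp
    let : Algebra T (Localization.Away a ⊗[A] T) := Algebra.TensorProduct.rightAlgebra
    have hloc : IsLocalization (Algebra.algebraMapSubmonoid T (Submonoid.powers a))
      (Localization.Away a ⊗[A] T) := inferInstance
    have hs' : s ∈ Set.range (comap (algebraMap T (Localization.Away a ⊗[A] T))) := by
      rw [localization_comap_range _ (Algebra.algebraMapSubmonoid T (Submonoid.powers a))]
      rw [Set.mem_ofPred_eq, Set.disjoint_left]
      rintro _ ⟨_, ⟨n, rfl⟩, rfl⟩ hn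
      have h1 : a ^ n ∈ (comap (algebraMap A T) s).asIdeal := hn
      rw [hs] at h1
      exact hp ((comap (algebraMap A (Localization.Away a)) p).2.mem_of_pow_mem n h1)
    obtain ⟨z, hz⟩ := hs'
    refine ⟨z, localization_comap_injective (Localization.Away a) (Submonoid.powers a) ?_⟩
    rw [← hs, ← hz, ← comap_comp_apply, ← comap_comp_apply]
    congr 1
    ext x
    change algebraMap A _ x ⊗ₜ[A] (1 : T) = (1 : Localization.Away a) ⊗ₜ[A] algebraMap A T x
    rw [Algebra.algebraMap_eq_smul_one, Algebra.algebraMap_eq_smul_one, smul_tmul]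
  have : Module.FaithfullyFlat (Localization.Away a) (Localization.Away a ⊗[A] T) :=
    .of_comap_surjective hsurj
  have : Algebra.FinitePresentation A (Localization.Away a) := IsLocalization.Away.finitePresentation a
  have : Algebra.FinitePresentation R (Localization.Away a) := .trans R A _
  let : Algebra T (Localization.Away a ⊗[A] T) := Algebra.TensorProduct.rightAlgebra
  have : IsScalarTower R T (Localization.Away a ⊗[A] T) := .of_algebraMap_eq fun r => by
    change algebraMap R _ r ⊗ₜ[A] (1 : T) = (1 : Localization.Away a) ⊗ₜ[A] algebraMap R T r
    rw [IsScalarTower.algebraMap_apply R A T, IsScalarTower.algebraMap_apply R A (Localization.Away a),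
      Algebra.algebraMap_eq_smul_one (A := Localization.Away a) (algebraMap R A r),
      Algebra.algebraMap_eq_smul_one (A := T) (algebraMap R A r), smul_tmul]
  have : Algebra.FormallyEtale T (Localization.Away a ⊗[A] T) :=
    .of_isLocalization (Algebra.algebraMapSubmonoid T (Submonoid.powers a))
  have : Algebra.FormallySmooth R (Localization.Away a ⊗[A] T) := .comp R T _
  have := smooth_of_isStandardEtale (R := R) (S := Localization.Away a)
    (T := Localization.Away a ⊗[A] T)
  exact Algebra.basicOpen_subset_smoothLocus_iff_smooth.mpr this ha

/-- The image of a smooth point under an étale map is smooth. -/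
theorem comap_mem_smoothLocus_of_etale {R A B : Type u} [CommRing R] [CommRing A] [CommRing B]
    [Algebra R A] [Algebra A B] [Algebra R B] [IsScalarTower R A B]
    [Algebra.FinitePresentation R A] [Algebra.Etale A B] {q : PrimeSpectrum B}
    (hq : q ∈ Algebra.smoothLocus R B) :
    comap (algebraMap A B) q ∈ Algebra.smoothLocus R A := by
  have : Algebra.FinitePresentation R B := .trans R A B
  have : Algebra.IsSmoothAt R q.asIdeal := hq
  obtain ⟨b, hbq, hb⟩ := Algebra.IsSmoothAt.exists_notMem_smooth R q.asIdeal
  obtain ⟨g, hgq, hg⟩ := Algebra.IsEtaleAt.exists_isStandardEtale (R := A) q.asIdeal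
  -- Shrink around `q` until the algebra is both standard étale over `A` and smooth over `R`.
  let T := Localization.Away (algebraMap B (Localization.Away g) b)
  have : IsLocalization.Away (g * b) T := .mul' (Localization.Away g) T g b
  have : Algebra.IsStandardEtale A T := .of_isLocalizationAway (algebraMap B (Localization.Away g) b)
  have hTs : Algebra.Smooth R T := by
    have h1 : Algebra.Smooth R (Localization.Away (g * b)) := by
      rw [← Algebra.basicOpen_subset_smoothLocus_iff_smooth] at hb ⊢
      exact Set.Subset.trans (SetLike.coe_subset_coe.mpr (basicOpen_mul_le_right g b)) hb
    exact .of_equiv ((IsLocalization.algEquiv (Submonoid.powers (g * b))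
      (Localization.Away (g * b)) T).restrictScalars R)
  have hqT : ∃ t : PrimeSpectrum T, comap (algebraMap B T) t = q := by
    have h1 : q ∈ Set.range (comap (algebraMap B T)) := by
      rw [localization_away_comap_range T (g * b)]
      exact q.2.mul_notMem hgq hbq
    exact h1
  obtain ⟨t, ht⟩ := hqT
  rw [← ht, ← comap_comp_apply, ← IsScalarTower.algebraMap_eq]
  exact comap_mem_smoothLocus_of_isStandardEtale t

/-- The image of a smooth point under an étale morphism is smooth. -/
theorem map_mem_smoothLocus_of_etale {X Y S : Scheme.{u}} (f : X ⟶ Y) [Etale f] (g : Y ⟶ S)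
    [LocallyOfFinitePresentation g] {x : X} (hx : x ∈ (f ≫ g).smoothLocus) :
    f x ∈ g.smoothLocus := by
  obtain ⟨_, ⟨U, hU, rfl⟩, hxU, -⟩ :=
    S.isBasis_affineOpens.exists_subset_of_mem_open (Set.mem_univ (g (f x))) isOpen_univ
  obtain ⟨_, ⟨V, hV, rfl⟩, hxV, hVU⟩ :=
    Y.isBasis_affineOpens.exists_subset_of_mem_open hxU (U.2.preimage g.continuous)
  obtain ⟨_, ⟨W, hW, rfl⟩, hxW, hWV⟩ :=
    X.isBasis_affineOpens.exists_subset_of_mem_open hxV (V.2.preimage f.continuous)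
  have h1 := g.finitePresentation_appLE hU hV hVU
  have h2 := f.etale_appLE hV hW hWV
  have hWU : W ≤ (f ≫ g) ⁻¹ᵁ U := fun y hy => hVU (hWV hy)
  have hcomp : g.appLE U V hVU ≫ f.appLE V W hWV = (f ≫ g).appLE U W hWU :=
    Scheme.Hom.appLE_comp_appLE _ _ _ _ _ _ _
  rw [Scheme.Hom.mem_smoothLocus, formallySmooth_stalkMap_iff U hU W hW hWU hxW] at hx
  rw [Scheme.Hom.mem_smoothLocus, formallySmooth_stalkMap_iff U hU V hV hVU hxV]
  algebraize [(g.appLE U V hVU).hom, (f.appLE V W hWV).hom, ((f ≫ g).appLE U W hWU).hom]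
  have : IsScalarTower Γ(S, U) Γ(Y, V) Γ(X, W) := .of_algebraMap_eq' (by
    change ((f ≫ g).appLE U W hWU).hom = _
    rw [← hcomp]; rfl)
  have h3 := comap_mem_smoothLocus_of_etale (R := Γ(S, U)) (A := Γ(Y, V)) hx
  convert h3
  exact (IsAffineOpen.comap_primeIdealOf_appLE V hV W hW hWV hxW).symm

theorem mem_smoothLocus_iff {S : Scheme.{u}} {X : Over S} [LocallyOfFinitePresentation X.hom]
    {x : X.left} : x ∈ smoothLocus X ↔ x ∈ X.hom.smoothLocus := by
  constructor
  · rintro ⟨U, hxU, hU⟩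
    have h1 := (U.ι ≫ X.hom).smoothLocus_eq_top
    rw [← Scheme.Hom.preimage_smoothLocus_eq] at h1
    exact h1.ge (show (⟨x, hxU⟩ : U) ∈ ⊤ from trivial)
  · intro hx
    refine ⟨X.hom.smoothLocus, hx, ?_⟩
    rw [← Scheme.Hom.smoothLocus_eq_top_iff, ← Scheme.Hom.preimage_smoothLocus_eq]
    ext y
    simp

end SmoothLocus

/-! ### Finiteness of projective varieties. -/

section Projective

attribute [local instance] MvPolynomial.gradedAlgebra

theorem locallyOfFiniteType_projectiveSpace (N : ℕ) (K : Type u) [Field K] :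
    LocallyOfFiniteType (projectiveSpace N K).hom := by
  have : Algebra.FiniteType (MvPolynomial.homogeneousSubmodule (Fin (N + 1)) K 0)
      (MvPolynomial (Fin (N + 1)) K) :=
    have : IsScalarTower K (MvPolynomial.homogeneousSubmodule (Fin (N + 1)) K 0)
        (MvPolynomial (Fin (N + 1)) K) :=
      IsScalarTower.of_algebraMap_eq (R := K)
        (S := MvPolynomial.homogeneousSubmodule (Fin (N + 1)) K 0) fun r => rfl
    Algebra.FiniteType.of_restrictScalars_finiteType K _ _
  have h2 : LocallyOfFiniteType (Spec.map (CommRingCat.ofHom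
      (algebraMap K (MvPolynomial.homogeneousSubmodule (Fin (N + 1)) K 0)))) := by
    rw [HasRingHomProperty.Spec_iff (P := @LocallyOfFiniteType)]
    refine RingHom.FiniteType.of_surjective _ ?_
    rintro ⟨x, hx⟩
    rw [MvPolynomial.homogeneousSubmodule_zero, Submodule.mem_one] at hx
    obtain ⟨c, hc⟩ := hx
    exact ⟨c, Subtype.ext hc⟩
  unfold projectiveSpace
  exact inferInstanceAs (LocallyOfFiniteType (_ ≫ _))

theorem IsProjectiveVariety.locallyOfFinitePresentation {K : Type u} [Field K]
    {X : Over (Spec (.of K))} (hX : IsProjectiveVariety X) : LocallyOfFinitePresentation X.hom := by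
  obtain ⟨N, i, hi⟩ := hX.projective
  have := locallyOfFiniteType_projectiveSpace N K
  rw [LocallyOfFinitePresentation.iff_locallyOfFiniteType, ← Over.w i]
  infer_instance

end Projective

/-! ### Restricting iterates to a component of the smooth locus. -/

section Restriction

/-- Let `Y` be open in `X` and maximal among the irreducible subsets of `S`. A continuous map
which preserves `S` and maps one point of `Y` into `Y` maps `Y` into `Y`. -/
theorem image_subset_of_maximal {X : Type*} [TopologicalSpace X] {S Y : Set X} {f : X → X}
    (hf : Continuous f) (hS : ∀ x ∈ S, f x ∈ S) (hYo : IsOpen Y)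
    (hY : Maximal (fun s => IsIrreducible s ∧ s ⊆ S) Y) {x : X} (hx : x ∈ Y) (hfx : f x ∈ Y) :
    f '' Y ⊆ Y := by
  -- The irreducible set `f '' Y` meets the open set `Y`, so the intersection is dense in it.
  -- Adjoining `f '' Y` to `Y` therefore keeps it irreducible, and maximality applies.
  have h1 : f '' Y ⊆ closure Y :=
    (subset_closure_inter_of_isPreirreducible_of_isOpen
      (hY.prop.1.image f hf.continuousOn).isPreirreducible hYo ⟨f x, ⟨x, hx, rfl⟩, hfx⟩).trans
      (closure_mono Set.inter_subset_right)
  have h2 : closure (Y ∪ f '' Y) = closure Y := by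
    rw [closure_union, Set.union_eq_left]
    exact closure_minimal h1 isClosed_closure
  have h3 : IsIrreducible (Y ∪ f '' Y) := by
    rw [← isIrreducible_iff_closure, h2, isIrreducible_iff_closure]
    exact hY.prop.1
  refine Set.subset_union_right.trans (hY.le_of_ge ⟨h3, ?_⟩ Set.subset_union_left)
  rintro y (hy | ⟨y, hy, rfl⟩)
  · exact hY.prop.2 hy
  · exact hS _ (hY.prop.2 hy)

variable {S : Scheme.{u}} {X : Over S}

theorem iter_add (φ : X ⟶ X) (i j : ℕ) : iter φ (i + j) = iter φ i ≫ iter φ j := by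
  induction j with
  | zero => simp
  | succ j ih => rw [← add_assoc, iter_succ, ih, iter_succ, Category.assoc]

theorem iter_mul (φ : X ⟶ X) (i j : ℕ) : iter φ (i * j) = iter (iter φ i) j := by
  induction j with
  | zero => simp
  | succ j ih => rw [Nat.mul_succ, iter_add, ih, iter_succ]

theorem etale_iter (φ : X ⟶ X) (hφ : Etale φ.left) (j : ℕ) : Etale (iter φ j).left := by
  induction j with
  | zero => exact inferInstanceAs (Etale (𝟙 X.left))
  | succ j ih => exact inferInstanceAs (Etale ((iter φ j).left ≫ φ.left))

theorem isPeriodicPt_iff {φ : X ⟶ X} {P : Point X} {j : ℕ} :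
    Function.IsPeriodicPt (fun Q : Point X => Q ≫ φ) j P ↔ P ≫ iter φ j = P := by
  rw [Function.IsPeriodicPt, Function.IsFixedPt, iterate_eq_comp_iter]

theorem primitivePeriod_congr {S' : Scheme.{u}} {X' : Over S'} {φ : X ⟶ X} {φ' : X' ⟶ X'}
    {P : Point X} {P' : Point X'} (h : ∀ j, P ≫ iter φ j = P ↔ P' ≫ iter φ' j = P') :
    primitivePeriod φ P = primitivePeriod φ' P' := by
  rw [primitivePeriod, primitivePeriod, Function.minimalPeriod_eq_minimalPeriod_iff]
  intro j
  rw [isPeriodicPt_iff, isPeriodicPt_iff, h]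

theorem primitivePeriod_dvd_iff {φ : X ⟶ X} {P : Point X} {j : ℕ} :
    primitivePeriod φ P ∣ j ↔ P ≫ iter φ j = P := by
  rw [primitivePeriod, ← Function.isPeriodicPt_iff_minimalPeriod_dvd, isPeriodicPt_iff]

theorem primitivePeriod_eq_mul_iter (φ : X ⟶ X) (P : Point X) {l : ℕ}
    (h : l ∣ primitivePeriod φ P) :
    primitivePeriod φ P = l * primitivePeriod (iter φ l) P := by
  refine Nat.dvd_antisymm ?_ ?_
  · rw [primitivePeriod_dvd_iff, iter_mul, comp_iter_primitivePeriod]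
  · obtain ⟨c, hc⟩ := h
    rw [hc]
    refine Nat.mul_dvd_mul_left l ?_
    rw [primitivePeriod_dvd_iff, ← iter_mul, ← hc, comp_iter_primitivePeriod]

instance mono_openInclusion (Y : X.left.Opens) : Mono (openInclusion Y) := by
  have : Mono (openInclusion Y).left := inferInstanceAs (Mono Y.ι)
  exact Over.mono_of_mono_left _

/-- Restriction to `Y` is detected by the single point `P`. The admissible exponents are closed
under addition and depend only on the residue modulo the period, so a nonzero remainder of the
period modulo `l` would be a smaller admissible exponent. -/
theorem exists_isLeast_restrict {K : Type u} [Field K] {X : Over (Spec (.of K))}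
    [LocallyOfFinitePresentation X.hom] (φ : X ⟶ X) (hφ : Etale φ.left) (P : Point X)
    (hn : 0 < primitivePeriod φ P) (Y : X.left.Opens)
    (hY : Maximal (fun s : Set X.left => IsIrreducible s ∧ s ⊆ smoothLocus X) (Y : Set X.left))
    (hP : P.pt ∈ Y) :
    ∃ l : ℕ,
      IsLeast {j : ℕ | 0 < j ∧ ∃ ψ : openSubscheme Y ⟶ openSubscheme Y,
        Etale ψ.left ∧ ψ ≫ openInclusion Y = openInclusion Y ≫ iter φ j} l ∧
      l ∣ primitivePeriod φ P := by
  have hS (j : ℕ) (x : X.left) (hx : x ∈ smoothLocus X) :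
      (iter φ j).left x ∈ smoothLocus X := by
    have := etale_iter φ hφ j
    rw [mem_smoothLocus_iff] at hx ⊢
    refine map_mem_smoothLocus_of_etale (iter φ j).left X.hom ?_
    have hw : (iter φ j).left ≫ X.hom = X.hom := Over.w _
    convert hx
  have hiff (j : ℕ) : (∃ ψ : openSubscheme Y ⟶ openSubscheme Y,
      Etale ψ.left ∧ ψ ≫ openInclusion Y = openInclusion Y ≫ iter φ j) ↔
      (iter φ j).left P.pt ∈ Y := by
    constructor
    · rintro ⟨ψ, -, hψ⟩
      have h1 : (openInclusion Y).left (ψ.left ⟨P.pt, hP⟩) = (iter φ j).left P.pt := by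
        have h2 := congr($(congrArg Over.Hom.left hψ) ⟨P.pt, hP⟩)
        exact h2
      rw [← h1]
      exact (ψ.left ⟨P.pt, hP⟩).2
    · intro h
      have := etale_iter φ hφ j
      have h1 := image_subset_of_maximal (iter φ j).left.continuous
        (hS j) Y.2 hY hP h
      have h2 : Set.range (Y.ι ≫ (iter φ j).left) ⊆ Set.range Y.ι := by
        rw [Scheme.Opens.range_ι]
        rintro _ ⟨y, rfl⟩
        exact h1 ⟨y.1, y.2, rfl⟩
      have h3 : IsOpenImmersion.lift Y.ι (Y.ι ≫ (iter φ j).left) h2 ≫ Y.ι =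
        Y.ι ≫ (iter φ j).left := IsOpenImmersion.lift_fac _ _ _
      refine ⟨Over.homMk (IsOpenImmersion.lift Y.ι (Y.ι ≫ (iter φ j).left) h2) ?_, ?_, ?_⟩
      · change _ ≫ Y.ι ≫ X.hom = Y.ι ≫ X.hom
        rw [reassoc_of% h3, Over.w]
      · have : Etale (IsOpenImmersion.lift Y.ι (Y.ι ≫ (iter φ j).left) h2 ≫ Y.ι) := by
          rw [h3]; infer_instance
        exact Etale.of_comp (IsOpenImmersion.lift Y.ι (Y.ι ≫ (iter φ j).left) h2) Y.ι
      · ext1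
        exact h3
  simp only [hiff]
  have hpt (i j : ℕ) : (iter φ (i + j)).left P.pt = (iter φ j).left ((iter φ i).left P.pt) := by
    rw [iter_add, Over.comp_left, Scheme.Hom.comp_apply]
  have hper (i : ℕ) : (iter φ (i + primitivePeriod φ P)).left P.pt = (iter φ i).left P.pt := by
    rw [add_comm, hpt]
    congr 1
    exact (pt_comp _ P P (comp_iter_primitivePeriod φ P)).symm
  have hadd (i j : ℕ) (hi : (iter φ i).left P.pt ∈ Y) (hj : (iter φ j).left P.pt ∈ Y) :
      (iter φ (i + j)).left P.pt ∈ Y := by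
    rw [hpt]
    exact image_subset_of_maximal (iter φ j).left.continuous
        (hS j) Y.2 hY hP hj ⟨_, hi, rfl⟩
  have hnS : (iter φ (primitivePeriod φ P)).left P.pt ∈ Y := by
    have := hper 0
    rw [zero_add] at this
    rw [this]
    exact hP
  classical
  have hex : ∃ j, 0 < j ∧ (iter φ j).left P.pt ∈ Y := ⟨_, hn, hnS⟩
  refine ⟨Nat.find hex, ⟨Nat.find_spec hex, fun j hj => Nat.find_min' hex hj⟩, ?_⟩
  set l := Nat.find hex with hl
  obtain ⟨hl0, hlY⟩ := Nat.find_spec hex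
  rw [← hl] at hl0 hlY
  by_contra hdvd
  have hr : 0 < primitivePeriod φ P % l := Nat.pos_of_ne_zero fun h => hdvd (Nat.dvd_of_mod_eq_zero h)
  have hmul (c : ℕ) : (iter φ (l * c)).left P.pt ∈ Y := by
    induction c with
    | zero => exact hP
    | succ c ih => rw [Nat.mul_succ]; exact hadd _ _ ih hlY
  have hperc (i c : ℕ) :
      (iter φ (i + c * primitivePeriod φ P)).left P.pt = (iter φ i).left P.pt := by
    induction c with
    | zero => simp
    | succ c ih => rw [Nat.succ_mul, ← add_assoc, hper, ih]
  -- `n % l = n - l (n / l) ≡ n + l (n / l) (n - 1)` modulo `n`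
  have key : (iter φ (primitivePeriod φ P % l)).left P.pt ∈ Y := by
    rw [← hperc _ (l * (primitivePeriod φ P / l))]
    have h1 : primitivePeriod φ P % l + l * (primitivePeriod φ P / l) * primitivePeriod φ P =
        primitivePeriod φ P + l * (primitivePeriod φ P / l * (primitivePeriod φ P - 1)) := by
      obtain ⟨n', hn'⟩ : ∃ n', primitivePeriod φ P = n' + 1 := ⟨_, (Nat.succ_pred hn.ne').symm⟩
      conv_rhs => rw [← Nat.mod_add_div (primitivePeriod φ P) l]
      have h2 : (primitivePeriod φ P % l + l * (primitivePeriod φ P / l)) / l =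
        primitivePeriod φ P / l := by rw [Nat.mod_add_div]
      have h3 : primitivePeriod φ P % l + l * (primitivePeriod φ P / l) - 1 =
        primitivePeriod φ P - 1 := by rw [Nat.mod_add_div]
      rw [h2, h3, hn', Nat.add_sub_cancel]
      ring
    rw [h1]
    exact hadd _ _ hnS (hmul _)
  exact absurd (Nat.find_min' hex ⟨hr, key⟩) (not_le.mpr (Nat.mod_lt _ hl0))

/-- Restricting `φ ^ l` to an open subscheme divides the period by `l`. -/
theorem primitivePeriod_eq_mul_of_restrict {φ : X ⟶ X} {P : Point X} {l : ℕ}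
    (h : l ∣ primitivePeriod φ P) {Y : X.left.Opens} {ψ : openSubscheme Y ⟶ openSubscheme Y}
    (hψ : ψ ≫ openInclusion Y = openInclusion Y ≫ iter φ l) {PY : Point (openSubscheme Y)}
    (hPY : PY ≫ openInclusion Y = P) :
    primitivePeriod φ P = l * primitivePeriod ψ PY := by
  rw [primitivePeriod_eq_mul_iter φ P h]
  congr 1
  refine primitivePeriod_congr fun j => ?_
  rw [← cancel_mono (openInclusion Y), Category.assoc, iter_comm _ _ _ hψ, ← Category.assoc, hPY]

end Restriction

/-! ### Morphisms from spectra of local rings. -/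

section FromSpecStalk

/-- A morphism from a local scheme to `Z` factors through the local ring of `Z` at the image of the
closed point. -/
theorem exists_comp_fromSpecStalk {Z : Scheme.{u}} {L : CommRingCat.{u}} [IsLocalRing L]
    (h : Spec L ⟶ Z) {z : Z} (hz : h (IsLocalRing.closedPoint L) = z) :
    ∃ g : Z.presheaf.stalk z ⟶ L, Spec.map g ≫ Z.fromSpecStalk z = h ∧ IsLocalHom g.hom := by
  subst hz
  exact ⟨Scheme.stalkClosedPointTo h, Scheme.Spec_stalkClosedPointTo_fromSpecStalk h, inferInstance⟩

theorem fromSpecStalk_hom_ext {Z : Scheme.{u}} {L : CommRingCat.{u}} {z : Z}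
    {g g' : Z.presheaf.stalk z ⟶ L}
    (h : Spec.map g ≫ Z.fromSpecStalk z = Spec.map g' ≫ Z.fromSpecStalk z) : g = g' :=
  Spec.map_injective ((cancel_mono _).mp h)

theorem exists_stalk_hom {Z Z' : Scheme.{u}} (f : Z ⟶ Z') {z : Z} {z' : Z'} (h : f z = z') :
    ∃ g : Z'.presheaf.stalk z' ⟶ Z.presheaf.stalk z,
      Spec.map g ≫ Z'.fromSpecStalk z' = Z.fromSpecStalk z ≫ f ∧ IsLocalHom g.hom ∧
      (SurjectiveOnStalks f → Function.Surjective g.hom) ∧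
      (IsOpenImmersion f → Function.Bijective g.hom) := by
  subst h
  refine ⟨f.stalkMap z, Scheme.SpecMap_stalkMap_fromSpecStalk f, inferInstance,
    fun _ => f.stalkMap_surjective z, fun _ => ?_⟩
  exact ConcreteCategory.bijective_of_isIso (f.stalkMap z)

end FromSpecStalk

/-! ### Functoriality of cotangent spaces at rational points. -/

section CotangentMap

variable {k : Type u} [Field k]

theorem map_localRingHom_fromSpecStalk {Z Z' : Over (Spec (.of k))} (f : Z ⟶ Z') (x : Point Z)
    (x' : Point Z') (h : x ≫ f = x') :
    Spec.map (localRingHom f x x' h) ≫ Z'.left.fromSpecStalk x'.pt =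
      Z.left.fromSpecStalk x.pt ≫ f.left := by
  subst h
  unfold localRingHom
  rw [Spec.map_comp, TopCat.Presheaf.stalkCongr_hom, Category.assoc]
  refine (congrArg (Spec.map (f.left.stalkMap x.pt) ≫ ·)
    (Scheme.SpecMap_stalkSpecializes_fromSpecStalk _)).trans ?_
  exact Scheme.SpecMap_stalkMap_fromSpecStalk f.left

theorem localRingHom_comp {Z Z' Z'' : Over (Spec (.of k))} (f : Z ⟶ Z') (g : Z' ⟶ Z'')
    (x : Point Z) (x' : Point Z') (x'' : Point Z'') (h : x ≫ f = x') (h' : x' ≫ g = x'')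
    (h'' : x ≫ f ≫ g = x'') :
    localRingHom (f ≫ g) x x'' h'' = localRingHom g x' x'' h' ≫ localRingHom f x x' h := by
  refine fromSpecStalk_hom_ext ?_
  rw [map_localRingHom_fromSpecStalk, Spec.map_comp, Category.assoc,
    map_localRingHom_fromSpecStalk, ← Category.assoc, map_localRingHom_fromSpecStalk,
    Category.assoc, Over.comp_left]

theorem cotangentMap_toCotangent {Z Z' : Over (Spec (.of k))} (f : Z ⟶ Z') (x : Point Z)
    (x' : Point Z') (h : x ≫ f = x') (b : IsLocalRing.maximalIdeal (LocalRingAt x'))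
    (hb : localAlgHom f x x' h b ∈ IsLocalRing.maximalIdeal (LocalRingAt x)) :
    cotangentMap f x x' h (Ideal.toCotangent _ b) = Ideal.toCotangent _ ⟨_, hb⟩ :=
  Ideal.mapCotangent_toCotangent _ _ _ _ _

theorem localAlgHom_mem {Z Z' : Over (Spec (.of k))} (f : Z ⟶ Z') (x : Point Z)
    (x' : Point Z') (h : x ≫ f = x') {b : LocalRingAt x'}
    (hb : b ∈ IsLocalRing.maximalIdeal (LocalRingAt x')) :
    localAlgHom f x x' h b ∈ IsLocalRing.maximalIdeal (LocalRingAt x) :=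
  map_nonunit (localRingHom f x x' h).hom b hb

theorem cotangentMap_comp {Z Z' Z'' : Over (Spec (.of k))} (f : Z ⟶ Z') (g : Z' ⟶ Z'')
    (x : Point Z) (x' : Point Z') (x'' : Point Z'') (h : x ≫ f = x') (h' : x' ≫ g = x'')
    (h'' : x ≫ f ≫ g = x'') (v : CotangentAt x'') :
    cotangentMap (f ≫ g) x x'' h'' v = cotangentMap f x x' h (cotangentMap g x' x'' h' v) := by
  obtain ⟨b, rfl⟩ := Ideal.toCotangent_surjective _ v
  rw [cotangentMap_toCotangent _ _ _ _ _ (localAlgHom_mem _ _ _ _ b.2),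
    cotangentMap_toCotangent _ _ _ _ _ (localAlgHom_mem _ _ _ _ b.2),
    cotangentMap_toCotangent _ _ _ _ _ (localAlgHom_mem _ _ _ _ (localAlgHom_mem _ _ _ _ b.2))]
  congr 2
  exact congr($(localRingHom_comp f g x x' x'' h h' h'') b.1)

theorem cotangentMap_surjective {Z Z' : Over (Spec (.of k))} (f : Z ⟶ Z') (x : Point Z)
    (x' : Point Z') (h : x ≫ f = x') [SurjectiveOnStalks f.left] :
    Function.Surjective (cotangentMap f x x' h) := by
  obtain ⟨g, hg, -, hs, -⟩ := exists_stalk_hom f.left (pt_comp f x x' h).symm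
  have hgl : g = localRingHom f x x' h :=
    fromSpecStalk_hom_ext (hg.trans (map_localRingHom_fromSpecStalk f x x' h).symm)
  subst hgl
  intro v
  obtain ⟨b, rfl⟩ := Ideal.toCotangent_surjective _ v
  obtain ⟨a, ha⟩ : ∃ a : LocalRingAt x', localAlgHom f x x' h a = b.1 := hs inferInstance b.1
  have ham : a ∈ IsLocalRing.maximalIdeal (LocalRingAt x') := by
    refine (IsLocalRing.mem_maximalIdeal _).mpr fun hu => ?_
    have h1 : IsUnit b.1 := by
      rw [← ha]
      exact hu.map (localAlgHom f x x' h)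
    exact (IsLocalRing.mem_maximalIdeal _).mp b.2 h1
  refine ⟨Ideal.toCotangent _ ⟨a, ham⟩, ?_⟩
  rw [cotangentMap_toCotangent _ _ _ _ _ (localAlgHom_mem _ _ _ _ ham)]
  congr 1
  exact Subtype.ext ha

end CotangentMap

/-! ### From the cotangent action to the period, for local rings. -/

section ReductionAlgebra

variable {R A B : Type*} [CommRing R] [IsDomain R] [IsDiscreteValuationRing R] [CommRing A]
  [IsLocalRing A] [Algebra R A] [CommRing B] [IsLocalRing B] {ϖ : R} {ε : A →ₐ[R] R} {g : A →+* B}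

theorem mem_maximalIdeal_of_mem_ker {x : A} (hx : x ∈ RingHom.ker ε) :
    x ∈ IsLocalRing.maximalIdeal A :=
  IsLocalRing.le_maximalIdeal (RingHom.ker_ne_top ε) hx

theorem dvd_of_mem_maximalIdeal (hϖ : Irreducible ϖ) {x : A}
    (hx : x ∈ IsLocalRing.maximalIdeal A) : ϖ ∣ ε x := by
  rw [← Ideal.mem_span_singleton, ← hϖ.maximalIdeal_eq, IsLocalRing.mem_maximalIdeal]
  intro hu
  have h1 : IsUnit (x - (x - algebraMap R A (ε x))) := by
    rw [sub_sub_cancel]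
    exact hu.map _
  exact (IsLocalRing.mem_maximalIdeal _).mp
    (sub_mem hx (mem_maximalIdeal_of_mem_ker (sub_algebraMap_mem_ker x))) h1

/-- A nonunit of `A` differs from an element of `I` by its augmentation, a multiple of `ϖ`, which
dies in `B`. -/
theorem maximalIdeal_eq_map_ker (hϖ : Irreducible ϖ) (hg : Function.Surjective g)
    (hgϖ : g (algebraMap R A ϖ) = 0) :
    IsLocalRing.maximalIdeal B = (RingHom.ker ε).map g := by
  have hloc : IsLocalHom g := hg.isLocalHom
  apply le_antisymm
  · intro b hb
    obtain ⟨a, rfl⟩ := hg b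
    obtain ⟨c, hc⟩ := dvd_of_mem_maximalIdeal (ε := ε) hϖ
      (((IsLocalRing.local_hom_TFAE g).out 0 4).mp hloc ▸ hb : a ∈ IsLocalRing.maximalIdeal A)
    have h1 : g a = g (a - algebraMap R A (ε a)) := by
      rw [map_sub, hc, map_mul, map_mul, hgϖ, zero_mul, sub_zero]
    rw [h1]
    exact Ideal.mem_map_of_mem g (sub_algebraMap_mem_ker a)
  · rw [Ideal.map_le_iff_le_comap]
    intro x hx
    exact map_nonunit g x (mem_maximalIdeal_of_mem_ker hx)

/-- The square of the maximal ideal of `B` is the image of `I²`, and the kernel of `g` lies in `ϖA =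
ϖR + ϖI`. This turns triviality on the cotangent space into a contraction with exponents `1, 1`. -/
theorem mem_augFiltration_of_map_mem_sq (hϖ : Irreducible ϖ) (hg : Function.Surjective g)
    (hgϖ : g (algebraMap R A ϖ) = 0) (hker : ∀ a, g a = 0 → algebraMap R A ϖ ∣ a) {a : A}
    (ha : g a ∈ IsLocalRing.maximalIdeal B ^ 2) : a ∈ augFiltration ϖ ε 1 1 := by
  rw [maximalIdeal_eq_map_ker (ε := ε) hϖ hg hgϖ, ← Ideal.map_pow,
    Ideal.mem_map_iff_of_surjective g hg] at ha
  obtain ⟨q, hq, hqa⟩ := ha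
  obtain ⟨a', ha'⟩ := hker (a - q) (by rw [map_sub, hqa, sub_self])
  refine ⟨ε a', a' - algebraMap R A (ε a'), sub_algebraMap_mem_ker a', q, hq, ?_⟩
  rw [eq_add_of_sub_eq ha', Algebra.smul_def, map_mul, map_pow]
  ring

/-- If the reduction of a section has trivial cotangent space, then the section is unramified: it
does not move under endomorphisms fixing its reduction. -/
theorem comp_eq_of_maximalIdeal_le_sq (hϖ : Irreducible ϖ) (hg : Function.Surjective g)
    (hgϖ : g (algebraMap R A ϖ) = 0) (hker : ∀ a, g a = 0 → algebraMap R A ϖ ∣ a)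
    (h : IsLocalRing.maximalIdeal B ≤ IsLocalRing.maximalIdeal B ^ 2) (ε' : A →ₐ[R] R) :
    ε' = ε := by
  have hsurj : Function.Surjective ε' := fun r => ⟨algebraMap R A r, ε'.commutes r⟩
  have hle : (RingHom.ker ε).map ε' ≤ Ideal.span {ϖ} := by
    rw [Ideal.map_le_iff_le_comap]
    intro x hx
    exact Ideal.mem_span_singleton.mpr
      (dvd_of_mem_maximalIdeal hϖ (mem_maximalIdeal_of_mem_ker hx))
  -- Write `x = ϖc + ϖy + q` with `y ∈ I` and `q ∈ I²`. Applying `ε` gives `ϖc = 0`, and `ε' q` lies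
  -- in the square of an ideal contained in `(ϖ)`; Nakayama then kills that ideal.
  have hJ : (RingHom.ker ε).map ε' ≤ Ideal.span {ϖ} • (RingHom.ker ε).map ε' := by
    rw [Ideal.map_le_iff_le_comap]
    intro x hx
    have hgx : g x ∈ IsLocalRing.maximalIdeal B ^ 2 := h (by
      rw [maximalIdeal_eq_map_ker (ε := ε) hϖ hg hgϖ]
      exact Ideal.mem_map_of_mem g hx)
    obtain ⟨c, y, hy, q, hq, rfl⟩ := mem_augFiltration_of_map_mem_sq (ε := ε) hϖ hg hgϖ hker hgx
    have hc : ϖ ^ 1 * c = 0 := by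
      have h1 : ε _ = 0 := hx
      have hy' : ε y = 0 := hy
      rwa [map_add, map_add, AlgHom.commutes, map_smul, hy', augmentation_eq_zero_of_mem_sq hq,
        smul_zero, add_zero, add_zero] at h1
    rw [hc, map_zero, zero_add, pow_one, Ideal.mem_comap, map_add, map_smul]
    refine add_mem ?_ ?_
    · exact Submodule.smul_mem_smul (Ideal.mem_span_singleton_self ϖ) (Ideal.mem_map_of_mem _ hy)
    · have h1 : ε' q ∈ (RingHom.ker ε ^ 2).map ε' := Ideal.mem_map_of_mem _ hq
      rw [Ideal.map_pow, pow_two] at h1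
      exact Ideal.mul_mono_left hle h1
  have h0 : (RingHom.ker ε).map ε' = ⊥ := by
    refine Submodule.eq_bot_of_le_smul_of_le_jacobson_bot (Ideal.span {ϖ}) _
      (IsNoetherian.noetherian _) hJ ?_
    rw [← hϖ.maximalIdeal_eq]
    exact IsLocalRing.maximalIdeal_le_jacobson _
  refine comp_eq_of_forall_mem_ker fun x hx => ?_
  have h1 := Ideal.mem_map_of_mem ε' hx
  rwa [h0] at h1

/-- Because `σ ^ N = 1` on all of `A`, and not just on `ε`, the order of the cotangent action
divides `N`. The power of `σ` by that order is a contraction, and its period `N / orderOf h` is a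
power of `p`. -/
theorem minimalPeriod_eq_orderOf_mul {k : Type*} [Field k] [Algebra k B] {σ : A →ₐ[R] A}
    {τ : B →+* B} (hϖ : Irreducible ϖ) (hg : Function.Surjective g)
    (hgϖ : g (algebraMap R A ϖ) = 0) (hker : ∀ a, g a = 0 → algebraMap R A ϖ ∣ a)
    (hστ : ∀ a, τ (g a) = g (σ a)) (h : Module.End k (IsLocalRing.CotangentSpace B))
    (hτ : ∀ b ∈ IsLocalRing.maximalIdeal B, τ b ∈ IsLocalRing.maximalIdeal B)
    (hh : ∀ b : IsLocalRing.maximalIdeal B, h (Ideal.toCotangent _ b) =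
      Ideal.toCotangent _ ⟨τ b, hτ b b.2⟩)
    (hpos : 0 < Function.minimalPeriod (fun η : A →ₐ[R] R => η.comp σ) ε)
    (hσ : σ ^ Function.minimalPeriod (fun η : A →ₐ[R] R => η.comp σ) ε = 1)
    {p : ℕ} (hp : p.Prime) (hpϖ : ϖ ∣ (p : R)) :
    ∃ e, Function.minimalPeriod (fun η : A →ₐ[R] R => η.comp σ) ε = orderOf h * p ^ e ∧
      ∀ v : ℕ, IsDiscreteValuationRing.addVal R (p : R) = v → ExponentBound p v e := by
  set N := Function.minimalPeriod (fun η : A →ₐ[R] R => η.comp σ) ε with hN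
  have hτj (j : ℕ) (b : B) (hb : b ∈ IsLocalRing.maximalIdeal B) :
      (τ ^ j) b ∈ IsLocalRing.maximalIdeal B := by
    induction j with
    | zero => exact hb
    | succ j ih => rw [pow_succ']; exact hτ _ ih
  have hhj (j : ℕ) (b : IsLocalRing.maximalIdeal B) : (h ^ j) (Ideal.toCotangent _ b) =
      Ideal.toCotangent _ ⟨(τ ^ j) b, hτj j b b.2⟩ := by
    induction j with
    | zero => rfl
    | succ j ih =>
      rw [pow_succ', Module.End.mul_apply, ih, hh]
      congr 2
      rw [pow_succ']
      rfl
  have hστj (j : ℕ) (a : A) : (τ ^ j) (g a) = g ((σ ^ j) a) := by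
    induction j with
    | zero => rfl
    | succ j ih =>
      rw [pow_succ', pow_succ', RingHom.mul_def, RingHom.comp_apply, ih, hστ]
      rfl
  have hhN : h ^ N = 1 := by
    refine LinearMap.ext fun v => ?_
    obtain ⟨b, rfl⟩ := Ideal.toCotangent_surjective _ v
    rw [hhj]
    obtain ⟨a, ha⟩ := hg b
    refine congrArg (Ideal.toCotangent _) (Subtype.ext ?_)
    change (τ ^ N) b.1 = b.1
    rw [← ha, hστj, hσ]
    rfl
  have hdvd : orderOf h ∣ N := orderOf_dvd_of_pow_eq_one hhN
  have hr0 : orderOf h ≠ 0 := fun h0 => by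
    rw [h0, zero_dvd_iff] at hdvd
    omega
  have hcontr : IsContraction ϖ ε (σ ^ orderOf h) 1 1 := by
    intro x hx
    refine mem_augFiltration_of_map_mem_sq (g := g) hϖ hg hgϖ hker ?_
    have hgx : g x ∈ IsLocalRing.maximalIdeal B := by
      rw [maximalIdeal_eq_map_ker (ε := ε) hϖ hg hgϖ]
      exact Ideal.mem_map_of_mem g hx
    have h1 := hhj (orderOf h) ⟨g x, hgx⟩
    rw [pow_orderOf_eq_one, Module.End.one_apply, eq_comm, Ideal.toCotangent_eq] at h1
    rwa [map_sub, ← hστj]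
  have hiter : Function.minimalPeriod (fun η : A →ₐ[R] R => η.comp (σ ^ orderOf h)) ε =
      N / orderOf h := by
    have h1 : (fun η : A →ₐ[R] R => η.comp (σ ^ orderOf h)) =
        (fun η : A →ₐ[R] R => η.comp σ)^[orderOf h] := by
      funext η
      rw [iterate_comp]
    rw [h1, Function.minimalPeriod_iterate_eq_div_gcd hr0, Nat.gcd_eq_right hdvd]
  obtain ⟨e, he, hb⟩ := hcontr.minimalPeriod_eq hϖ hp hpϖ (by
    rw [hiter]
    exact Nat.div_pos (Nat.le_of_dvd hpos hdvd) (Nat.pos_of_ne_zero hr0))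
  refine ⟨e, ?_, hb⟩
  rw [← he, hiter, Nat.mul_div_cancel' hdvd]

end ReductionAlgebra

/-! ### Local rings along sections and their reductions. -/

section SectionRing

variable {R : Type u} [CommRing R] [IsLocalRing R] {Z : Over (Spec (.of R))}

/-- The image of the closed point under a section. -/
noncomputable def Point.closed (Q : Point Z) : Z.left :=
  Q.left (IsLocalRing.closedPoint R)

/-- The local ring of `Z` at the image of the closed point under a section. -/
noncomputable def SectionRing (Q : Point Z) : Type u :=
  Z.left.presheaf.stalk Q.closed

noncomputable instance (Q : Point Z) : CommRing (SectionRing Q) :=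
  inferInstanceAs (CommRing (Z.left.presheaf.stalk Q.closed))

instance (Q : Point Z) : IsLocalRing (SectionRing Q) :=
  inferInstanceAs (IsLocalRing (Z.left.presheaf.stalk Q.closed))

/-- The morphism to `Z` from the spectrum of its local ring along a section. -/
noncomputable def fromSpecSectionRing (Q : Point Z) : Spec (.of (SectionRing Q)) ⟶ Z.left :=
  Z.left.fromSpecStalk Q.closed

noncomputable instance (Q : Point Z) : Algebra R (SectionRing Q) :=
  (Spec.preimage (fromSpecSectionRing Q ≫ Z.hom)).hom.toAlgebra

theorem map_algebraMap_sectionRing (Q : Point Z) :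
    Spec.map (CommRingCat.ofHom (algebraMap R (SectionRing Q))) =
      fromSpecSectionRing Q ≫ Z.hom :=
  Spec.map_preimage _

instance (Q : Point Z) : Mono (fromSpecSectionRing Q) :=
  inferInstanceAs (Mono (Z.left.fromSpecStalk Q.closed))

theorem fromSpecSectionRing_hom_ext {Q : Point Z} {L : Type u} [CommRing L]
    {g g' : SectionRing Q →+* L}
    (h : Spec.map (CommRingCat.ofHom g) ≫ fromSpecSectionRing Q =
      Spec.map (CommRingCat.ofHom g') ≫ fromSpecSectionRing Q) : g = g' :=
  congrArg CommRingCat.Hom.hom (Spec.map_injective ((cancel_mono _).mp h))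

theorem exists_augmentation (Q : Point Z) : ∃ ε : SectionRing Q →ₐ[R] R,
    Spec.map (CommRingCat.ofHom ε.toRingHom) ≫ fromSpecSectionRing Q = Q.left := by
  obtain ⟨g, hg⟩ : ∃ g : SectionRing Q →+* R,
      Spec.map (CommRingCat.ofHom g) ≫ fromSpecSectionRing Q = Q.left := by
    obtain ⟨g, hg, -⟩ := exists_comp_fromSpecStalk (L := .of R) Q.left (z := Q.closed) rfl
    exact ⟨g.hom, hg⟩
  have h1 : CommRingCat.ofHom (algebraMap R (SectionRing Q)) ≫ CommRingCat.ofHom g = 𝟙 _ := by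
    refine Spec.map_injective ?_
    rw [Spec.map_comp, map_algebraMap_sectionRing, ← Category.assoc]
    refine (congrArg (· ≫ Z.hom) hg).trans ?_
    rw [Spec.map_id]
    exact Over.w Q
  exact ⟨{ g with commutes' := fun r => congr($h1 r) }, hg⟩

theorem exists_sectionRing_endo (Q : Point Z) (f : Z ⟶ Z) (hf : f.left Q.closed = Q.closed) :
    ∃ σ : SectionRing Q →ₐ[R] SectionRing Q,
      Spec.map (CommRingCat.ofHom σ.toRingHom) ≫ fromSpecSectionRing Q =
        fromSpecSectionRing Q ≫ f.left := by
  obtain ⟨g, hg⟩ : ∃ g : SectionRing Q →+* SectionRing Q,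
      Spec.map (CommRingCat.ofHom g) ≫ fromSpecSectionRing Q =
        fromSpecSectionRing Q ≫ f.left := by
    obtain ⟨g, hg, -⟩ := exists_stalk_hom f.left hf
    exact ⟨g.hom, hg⟩
  have h1 : CommRingCat.ofHom (algebraMap R (SectionRing Q)) ≫ CommRingCat.ofHom g =
      CommRingCat.ofHom (algebraMap R (SectionRing Q)) := by
    refine Spec.map_injective ?_
    rw [Spec.map_comp, map_algebraMap_sectionRing, ← Category.assoc]
    refine (congrArg (· ≫ Z.hom) hg).trans ?_
    rw [Category.assoc, Over.w]
  exact ⟨{ g with commutes' := fun r => congr($h1 r) }, hg⟩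

theorem map_pow_fromSpecSectionRing {Q : Point Z} {f : Z ⟶ Z}
    {σ : SectionRing Q →ₐ[R] SectionRing Q}
    (hσ : Spec.map (CommRingCat.ofHom σ.toRingHom) ≫ fromSpecSectionRing Q =
        fromSpecSectionRing Q ≫ f.left) (j : ℕ) :
    Spec.map (CommRingCat.ofHom (σ ^ j).toRingHom) ≫ fromSpecSectionRing Q =
        fromSpecSectionRing Q ≫ (iter f j).left := by
  induction j with
  | zero =>
    have h1 : Spec.map (CommRingCat.ofHom (σ ^ 0).toRingHom) = 𝟙 _ := Spec.map_id _
    rw [h1, Category.id_comp]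
    exact (Category.comp_id _).symm
  | succ j ih =>
    have h1 : Spec.map (CommRingCat.ofHom (σ ^ (j + 1)).toRingHom) =
        Spec.map (CommRingCat.ofHom (σ ^ j).toRingHom) ≫
          Spec.map (CommRingCat.ofHom σ.toRingHom) := by
      rw [← Spec.map_comp, pow_succ]
      rfl
    rw [h1, Category.assoc, hσ, reassoc_of% ih, iter_succ, Over.comp_left]

/-- The morphism from the spectrum of the local ring is a monomorphism, so equality of sections that
factor through it can be tested on augmentations. -/
theorem primitivePeriod_eq_minimalPeriod {Q : Point Z} {f : Z ⟶ Z}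
    {σ : SectionRing Q →ₐ[R] SectionRing Q}
    (hσ : Spec.map (CommRingCat.ofHom σ.toRingHom) ≫ fromSpecSectionRing Q =
        fromSpecSectionRing Q ≫ f.left) {ε : SectionRing Q →ₐ[R] R}
    (hε : Spec.map (CommRingCat.ofHom ε.toRingHom) ≫ fromSpecSectionRing Q = Q.left) :
    primitivePeriod f Q =
      Function.minimalPeriod (fun η : SectionRing Q →ₐ[R] R => η.comp σ) ε := by
  rw [primitivePeriod, Function.minimalPeriod_eq_minimalPeriod_iff]
  intro j
  rw [isPeriodicPt_iff, Function.IsPeriodicPt, Function.IsFixedPt, iterate_comp]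
  have h1 : (Q ≫ iter f j).left =
      Spec.map (CommRingCat.ofHom (ε.comp (σ ^ j)).toRingHom) ≫ fromSpecSectionRing Q := by
    have h2 : Spec.map (CommRingCat.ofHom (ε.comp (σ ^ j)).toRingHom) =
        Spec.map (CommRingCat.ofHom ε.toRingHom) ≫
          Spec.map (CommRingCat.ofHom (σ ^ j).toRingHom) := by
      rw [← Spec.map_comp]; rfl
    rw [h2, Category.assoc, map_pow_fromSpecSectionRing hσ, reassoc_of% hε, Over.comp_left]
  constructor
  · intro h
    refine AlgHom.coe_ringHom_injective (fromSpecSectionRing_hom_ext ?_)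
    exact h1.symm.trans ((congrArg Over.Hom.left h).trans hε.symm)
  · intro h
    ext1
    rw [h1, h, hε]

theorem baseChangePoint_left_fst (Q : Point Z) :
    (baseChangePoint (closedPt R) Q).left ≫ pullback.fst Z.hom (closedPt R) =
      closedPt R ≫ Q.left :=
  pullback.lift_fst _ _ _

theorem fst_pt_baseChangePoint (Q : Point Z) :
    pullback.fst Z.hom (closedPt R) (baseChangePoint (closedPt R) Q).pt = Q.closed := by
  have h1 := congr($(baseChangePoint_left_fst Q)
    (IsLocalRing.closedPoint (IsLocalRing.ResidueField R)))
  refine h1.trans ?_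
  change Q.left (closedPt R (IsLocalRing.closedPoint (IsLocalRing.ResidueField R))) = _
  rw [show closedPt R (IsLocalRing.closedPoint (IsLocalRing.ResidueField R)) =
    IsLocalRing.closedPoint R from IsLocalRing.comap_closedPoint (IsLocalRing.residue R)]
  rfl

theorem baseChangeMap_left_fst {Z' : Over (Spec (.of R))} (f : Z ⟶ Z') :
    (baseChangeMap (closedPt R) f).left ≫ pullback.fst Z'.hom (closedPt R) =
      pullback.fst Z.hom (closedPt R) ≫ f.left :=
  pullback.lift_fst _ _ _

theorem closed_eq_of_fixed {Q : Point Z} {f : Z ⟶ Z}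
    (h : baseChangePoint (closedPt R) Q ≫ baseChangeMap (closedPt R) f =
      baseChangePoint (closedPt R) Q) : f.left Q.closed = Q.closed := by
  have h1 := congr($(baseChangeMap_left_fst f) (baseChangePoint (closedPt R) Q).pt)
  rw [← fst_pt_baseChangePoint]
  refine h1.symm.trans ?_
  exact congrArg (pullback.fst Z.hom (closedPt R)) (pt_comp _ _ _ h).symm

instance isClosedImmersion_closedPt : IsClosedImmersion (closedPt R) :=
  IsClosedImmersion.spec_of_surjective _ IsLocalRing.residue_surjective

/-- The morphism to `Z` from the spectrum of its local ring at a rational point. -/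
noncomputable def fromSpecLocalRingAt {k : Type u} [Field k] {Z : Over (Spec (.of k))}
    (x : Point Z) : Spec (.of (LocalRingAt x)) ⟶ Z.left :=
  Z.left.fromSpecStalk x.pt

instance {k : Type u} [Field k] {Z : Over (Spec (.of k))} (x : Point Z) :
    Mono (fromSpecLocalRingAt x) :=
  inferInstanceAs (Mono (Z.left.fromSpecStalk x.pt))

theorem map_algebraMap_localRingAt {k : Type u} [Field k] {Z : Over (Spec (.of k))}
    (x : Point Z) : Spec.map (CommRingCat.ofHom (algebraMap k (LocalRingAt x))) =
      fromSpecLocalRingAt x ≫ Z.hom := by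
  change Spec.map (structureMapAt Z x.pt) = Z.left.fromSpecStalk x.pt ≫ Z.hom
  rw [structureMapAt, Spec.map_comp, Spec.map_comp, ← Scheme.fromSpecStalk_toSpecΓ, Category.assoc,
    Category.assoc, ← Scheme.toSpecΓ_naturality_assoc, ← SpecMap_ΓSpecIso_hom,
    ← Spec.map_comp, Iso.inv_hom_id, Spec.map_id, Category.comp_id]

/-- The local ring of the special fibre at the reduction of a section is the quotient of the local
ring along the section by the maximal ideal of the base. -/
theorem exists_reduction (Q : Point Z) :
    ∃ g : SectionRing Q →+* LocalRingAt (baseChangePoint (closedPt R) Q),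
      Function.Surjective g ∧
      (∀ r, g (algebraMap R _ r) = algebraMap (IsLocalRing.ResidueField R) _
        (IsLocalRing.residue R r)) ∧
      RingHom.ker g ≤ (IsLocalRing.maximalIdeal R).map (algebraMap R (SectionRing Q)) ∧
      Spec.map (CommRingCat.ofHom g) ≫ fromSpecSectionRing Q =
        fromSpecLocalRingAt (baseChangePoint (closedPt R) Q) ≫
          pullback.fst Z.hom (closedPt R) := by
  have hcl : IsClosedImmersion (pullback.fst Z.hom (closedPt R)) := inferInstance
  obtain ⟨g, hg, hsurj⟩ : ∃ g : SectionRing Q →+* LocalRingAt (baseChangePoint (closedPt R) Q),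
      Spec.map (CommRingCat.ofHom g) ≫ fromSpecSectionRing Q =
        fromSpecLocalRingAt (baseChangePoint (closedPt R) Q) ≫
          pullback.fst Z.hom (closedPt R) ∧ Function.Surjective g := by
    obtain ⟨g, hg, -, hs, -⟩ := exists_stalk_hom (pullback.fst Z.hom (closedPt R))
      (fst_pt_baseChangePoint Q)
    exact ⟨g.hom, hg, hs inferInstance⟩
  refine ⟨g, hsurj, fun r => ?_, ?_, hg⟩
  · have h1 : CommRingCat.ofHom (algebraMap R (SectionRing Q)) ≫ CommRingCat.ofHom g =
        CommRingCat.ofHom (IsLocalRing.residue R) ≫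
          CommRingCat.ofHom (algebraMap (IsLocalRing.ResidueField R) _) := by
      refine Spec.map_injective ?_
      rw [Spec.map_comp, Spec.map_comp, map_algebraMap_sectionRing, map_algebraMap_localRingAt,
        reassoc_of% hg, Category.assoc]
      exact congrArg (fromSpecLocalRingAt (baseChangePoint (closedPt R) Q) ≫ ·) pullback.condition
    exact congr($h1 r)
  · set J := (IsLocalRing.maximalIdeal R).map (algebraMap R (SectionRing Q)) with hJ
    obtain ⟨ε, hε⟩ := exists_augmentation Q
    have hJm : J ≤ IsLocalRing.maximalIdeal (SectionRing Q) := by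
      rw [hJ, Ideal.map_le_iff_le_comap]
      intro r hr
      refine (IsLocalRing.mem_maximalIdeal _).mpr fun hu => ?_
      have h2 : IsUnit (ε (algebraMap R _ r)) := hu.map ε
      rw [AlgHom.commutes] at h2
      exact (IsLocalRing.mem_maximalIdeal _).mp hr h2
    have hnt : Nontrivial (SectionRing Q ⧸ J) :=
      Ideal.Quotient.nontrivial_iff.mpr fun h => IsLocalRing.maximalIdeal.isMaximal _ |>.ne_top
        (top_le_iff.mp (h ▸ hJm))
    have hloc : IsLocalRing (SectionRing Q ⧸ J) :=
      .of_surjective' (Ideal.Quotient.mk J) Ideal.Quotient.mk_surjective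
    let q : IsLocalRing.ResidueField R →+* SectionRing Q ⧸ J :=
      Ideal.Quotient.lift _ ((Ideal.Quotient.mk J).comp (algebraMap R (SectionRing Q)))
        fun r hr => Ideal.Quotient.eq_zero_iff_mem.mpr (Ideal.mem_map_of_mem _ hr)
    have hq : q.comp (IsLocalRing.residue R) =
        (Ideal.Quotient.mk J).comp (algebraMap R (SectionRing Q)) := by
      ext r; rfl
    -- The quotient by the maximal ideal of `R` maps to the special fibre and so factors through its
    -- local ring. The resulting map composes with `g` to the quotient map, which bounds the kernel
    -- of `g`.
    let u : Spec (.of (SectionRing Q ⧸ J)) ⟶ pullback Z.hom (closedPt R) :=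
      pullback.lift (Spec.map (CommRingCat.ofHom (Ideal.Quotient.mk J)) ≫ fromSpecSectionRing Q)
        (Spec.map (CommRingCat.ofHom q)) (by
          rw [Category.assoc, ← map_algebraMap_sectionRing, ← Spec.map_comp, ← Spec.map_comp,
            ← CommRingCat.ofHom_comp, ← CommRingCat.ofHom_comp, hq])
    have hu1 : u ≫ pullback.fst Z.hom (closedPt R) =
        Spec.map (CommRingCat.ofHom (Ideal.Quotient.mk J)) ≫ fromSpecSectionRing Q :=
      pullback.lift_fst _ _ _
    have hu : u (IsLocalRing.closedPoint (SectionRing Q ⧸ J)) =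
        (baseChangePoint (closedPt R) Q).pt := by
      refine hcl.isClosedEmbedding.injective ?_
      rw [fst_pt_baseChangePoint]
      refine congr($hu1 (IsLocalRing.closedPoint (SectionRing Q ⧸ J))).trans ?_
      have hl : IsLocalHom (Ideal.Quotient.mk J) := Ideal.Quotient.mk_surjective.isLocalHom
      have h2 : Spec.map (CommRingCat.ofHom (Ideal.Quotient.mk J))
          (IsLocalRing.closedPoint (SectionRing Q ⧸ J)) = IsLocalRing.closedPoint (SectionRing Q) :=
        IsLocalRing.comap_closedPoint (Ideal.Quotient.mk J)
      refine (congrArg (fromSpecSectionRing Q) h2).trans ?_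
      exact Scheme.fromSpecStalk_closedPoint
    obtain ⟨g2, hg2⟩ : ∃ g2 : LocalRingAt (baseChangePoint (closedPt R) Q) →+* SectionRing Q ⧸ J,
        Spec.map (CommRingCat.ofHom g2) ≫ fromSpecLocalRingAt (baseChangePoint (closedPt R) Q) =
          u := by
      obtain ⟨g2, hg2, -⟩ := exists_comp_fromSpecStalk u hu
      exact ⟨g2.hom, hg2⟩
    have h3 : g2.comp g = Ideal.Quotient.mk J := by
      refine fromSpecSectionRing_hom_ext ?_
      rw [CommRingCat.ofHom_comp, Spec.map_comp, Category.assoc, hg, ← hu1, ← hg2, Category.assoc]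
    intro a ha
    have h4 := congr($h3 a)
    rw [RingHom.comp_apply, show g a = 0 from ha, map_zero, eq_comm] at h4
    exact Ideal.Quotient.eq_zero_iff_mem.mp h4

end SectionRing

/-! ### Periods of sections and the union of the orbit. -/

section SectionPeriod

theorem iter_baseChangeMap {S T : Scheme.{u}} (s : T ⟶ S) {X : Over S} (f : X ⟶ X) (j : ℕ) :
    iter (baseChangeMap s f) j = baseChangeMap s (iter f j) := by
  induction j with
  | zero => exact ((Over.pullback s).map_id X).symm
  | succ j ih => rw [iter_succ, ih, iter_succ, ← Functor.map_comp]

variable {R : Type u} [CommRing R] [IsDomain R] [IsDiscreteValuationRing R]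
  {Z : Over (Spec (.of R))}

/-- Let an automorphism of finite order of an `R`-scheme fix the reduction of a section `Q`. Then
the period of `Q` is the order of the action on the cotangent space of the special fibre, up to a
power of `p` which is bounded; and it is `1` if that cotangent space vanishes. -/
theorem primitivePeriod_eq_orderOf_mul [Finite (IsLocalRing.ResidueField R)] (p : ℕ)
    [CharP (IsLocalRing.ResidueField R) p] (Q : Point Z) (f : Z ⟶ Z)
    {F : baseChange (closedPt R) Z ⟶ baseChange (closedPt R) Z}
    (hF : F = baseChangeMap (closedPt R) f)
    (hfix : baseChangePoint (closedPt R) Q ≫ F = baseChangePoint (closedPt R) Q)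
    (hpos : 0 < primitivePeriod f Q) (hone : iter f (primitivePeriod f Q) = 𝟙 Z) :
    (∃ e, primitivePeriod f Q = orderOf (cotangentMap F _ _ hfix) * p ^ e ∧
      ∀ v : ℕ, IsDiscreteValuationRing.addVal R (p : R) = v → ExponentBound p v e) ∧
    (Subsingleton (CotangentAt (baseChangePoint (closedPt R) Q)) → primitivePeriod f Q = 1) := by
  subst hF
  obtain ⟨ϖ, hϖ⟩ := IsDiscreteValuationRing.exists_irreducible R
  have hp : p.Prime := (CharP.char_is_prime_or_zero (IsLocalRing.ResidueField R) p).resolve_right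
    (CharP.char_ne_zero_of_finite (IsLocalRing.ResidueField R) p)
  have hpϖ : ϖ ∣ (p : R) := by
    rw [← Ideal.mem_span_singleton, ← hϖ.maximalIdeal_eq, ← IsLocalRing.residue_eq_zero_iff,
      map_natCast, CharP.cast_eq_zero]
  obtain ⟨ε, hε⟩ := exists_augmentation Q
  obtain ⟨σ, hσ⟩ := exists_sectionRing_endo Q f (closed_eq_of_fixed hfix)
  obtain ⟨g, hg, hgr, hker, hgZ⟩ := exists_reduction Q
  have hgϖ : g (algebraMap R _ ϖ) = 0 := by
    rw [hgr, (IsLocalRing.residue_eq_zero_iff ϖ).mpr, map_zero]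
    exact hϖ.not_isUnit
  have hker' (a : SectionRing Q) (ha : g a = 0) : algebraMap R _ ϖ ∣ a := by
    have h1 := hker ha
    rwa [hϖ.maximalIdeal_eq, Ideal.map_span, Set.image_singleton, Ideal.mem_span_singleton] at h1
  rw [primitivePeriod_eq_minimalPeriod hσ hε] at *
  have hσ1 : σ ^ Function.minimalPeriod (fun η : SectionRing Q →ₐ[R] R => η.comp σ) ε = 1 := by
    refine AlgHom.coe_ringHom_injective (fromSpecSectionRing_hom_ext ?_)
    refine (map_pow_fromSpecSectionRing hσ _).trans ?_
    rw [hone]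
    refine (Category.comp_id _).trans ?_
    have h1 : Spec.map (CommRingCat.ofHom
      ((1 : SectionRing Q →ₐ[R] SectionRing Q) : SectionRing Q →+* SectionRing Q)) = 𝟙 _ :=
      Spec.map_id _
    rw [h1, Category.id_comp]
  let τ : LocalRingAt (baseChangePoint (closedPt R) Q) →+*
      LocalRingAt (baseChangePoint (closedPt R) Q) :=
    (localAlgHom (baseChangeMap (closedPt R) f) _ _ hfix).toRingHom
  have hτ : Spec.map (CommRingCat.ofHom τ) ≫
      fromSpecLocalRingAt (baseChangePoint (closedPt R) Q) =
      fromSpecLocalRingAt (baseChangePoint (closedPt R) Q) ≫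
        (baseChangeMap (closedPt R) f).left :=
    map_localRingHom_fromSpecStalk _ _ _ hfix
  have hστ : τ.comp g = g.comp σ.toRingHom := by
    refine fromSpecSectionRing_hom_ext ?_
    rw [CommRingCat.ofHom_comp, CommRingCat.ofHom_comp, Spec.map_comp, Spec.map_comp,
      Category.assoc, Category.assoc, hσ, hgZ, reassoc_of% hgZ, reassoc_of% hτ,
      baseChangeMap_left_fst]
  refine ⟨minimalPeriod_eq_orderOf_mul (τ := τ) hϖ hg hgϖ hker' (fun a => congr($hστ a))
    _ (fun b hb => localAlgHom_mem _ _ _ hfix hb)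
    (fun b => cotangentMap_toCotangent _ _ _ hfix b (localAlgHom_mem _ _ _ hfix b.2)) hpos hσ1
    hp hpϖ, fun hV => ?_⟩
  rw [Function.minimalPeriod_eq_one_iff_isFixedPt]
  refine comp_eq_of_maximalIdeal_le_sq hϖ hg hgϖ hker' ?_ _
  rw [pow_two]
  exact ((Ideal.cotangent_subsingleton_iff _).mp hV).symm.le

/-- On the union of a finite orbit in a separated scheme, the map has finite order. -/
theorem iter_orbitMap_primitivePeriod {S : Scheme.{u}} {X : Over S} [IsSeparated X.hom]
    (φ : X ⟶ X) (P : Point X) :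
    iter (orbitMap φ P) (primitivePeriod φ P) = 𝟙 (orbit φ P) := by
  set n := primitivePeriod φ P with hn
  -- By separatedness the equalizer is a closed subscheme. Every point of the orbit factors through
  -- it, so it contains their scheme-theoretic union.
  let i := equalizer.ι (iter φ n) (𝟙 X)
  have hi : IsClosedImmersion i.left := inferInstance
  have hle : i.left.ker ≤ (orbitι φ P).left.ker := by
    have h1 : (orbitι φ P).left.ker = orbitIdeal φ P :=
      Scheme.IdealSheafData.ker_subschemeι _
    rw [h1]
    refine le_iInf fun j => ?_
    have h2 : (P ≫ iter φ j) ≫ iter φ n = (P ≫ iter φ j) ≫ 𝟙 X := by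
      rw [Category.assoc, ← iter_add, add_comm, iter_add, ← Category.assoc, hn,
        comp_iter_primitivePeriod, Category.comp_id]
    have h3 : (P ≫ iter φ j).left = (equalizer.lift _ h2).left ≫ i.left := by
      rw [← Over.comp_left, equalizer.lift_ι]
    rw [h3]
    exact Scheme.Hom.le_ker_comp _ _
  have h4 := IsClosedImmersion.lift_fac i.left (orbitι φ P).left hle
  rw [← cancel_mono (orbitι φ P), iter_comm _ _ _ (orbitMap_comp_orbitι φ P), Category.id_comp]
  ext1
  have h5 : i.left ≫ (iter φ n).left = i.left := by
    rw [← Over.comp_left, equalizer.condition, Category.comp_id]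
  rw [Over.comp_left, ← h4, Category.assoc, h5]

theorem primitivePeriod_orbitMap {S : Scheme.{u}} {X : Over S} (φ : X ⟶ X) (P : Point X) :
    primitivePeriod (orbitMap φ P) (orbitPoint φ P) = primitivePeriod φ P := by
  refine primitivePeriod_congr fun j => ?_
  rw [← cancel_mono (orbitι φ P), Category.assoc, iter_comm _ _ _ (orbitMap_comp_orbitι φ P),
    ← Category.assoc, orbitPoint_comp_orbitι]

theorem reducedPeriod_dvd {Z : Over (Spec (.of R))} (f : Z ⟶ Z) (Q : Point Z) :
    reducedPeriod f Q ∣ primitivePeriod f Q := by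
  rw [reducedPeriod, primitivePeriod_dvd_iff, iter_baseChangeMap, baseChangePoint_comp,
    comp_iter_primitivePeriod]

/-- Apply the previous computation to the `m`-th iterate on the orbit: it fixes the reduction, and
its power by the remaining period is the identity of the whole orbit scheme. -/
theorem primitivePeriod_eq_reducedPeriod_mul [Finite (IsLocalRing.ResidueField R)] (p : ℕ)
    [CharP (IsLocalRing.ResidueField R) p] [IsSeparated Z.hom] (f : Z ⟶ Z) (Q : Point Z)
    (hpos : 0 < primitivePeriod f Q) :
    (∃ e, primitivePeriod f Q = reducedPeriod f Q * (orderOf (orbitCotangentMap f Q) * p ^ e) ∧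
      ∀ v : ℕ, IsDiscreteValuationRing.addVal R (p : R) = v → ExponentBound p v e) ∧
    (Subsingleton (orbitCotangent f Q) → primitivePeriod f Q = reducedPeriod f Q) := by
  have h1 := primitivePeriod_orbitMap f Q
  have h2 := primitivePeriod_eq_mul_iter (orbitMap f Q) (orbitPoint f Q)
    (h1 ▸ reducedPeriod_dvd f Q)
  rw [h1] at h2
  have hpos' : 0 < primitivePeriod (iter (orbitMap f Q) (reducedPeriod f Q)) (orbitPoint f Q) :=
    Nat.pos_of_mul_pos_left (h2 ▸ hpos)
  obtain ⟨⟨e, he, hb⟩, h0⟩ := primitivePeriod_eq_orderOf_mul p (orbitPoint f Q)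
    (iter (orbitMap f Q) (reducedPeriod f Q)) (iter_baseChangeMap _ _ _)
    (baseChangePoint_orbitPoint_fixed f Q) hpos'
    (by rw [← iter_mul, ← h2, iter_orbitMap_primitivePeriod])
  refine ⟨⟨e, ?_, hb⟩, fun hV => ?_⟩
  · rw [h2, he]; rfl
  · rw [h2, h0 hV, mul_one]

end SectionPeriod

/-! ### The cotangent space of the orbit as an equivariant quotient. -/

section OrbitCotangent

variable {R : Type u} [CommRing R] [IsLocalRing R] {Z : Over (Spec (.of R))}

/-- The surjection from the cotangent space of the special fibre to that of the orbit. -/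
noncomputable def orbitCotangentProj (f : Z ⟶ Z) (Q : Point Z) :
    reducedCotangent Q →ₗ[IsLocalRing.ResidueField R] orbitCotangent f Q :=
  cotangentMap (baseChangeMap (closedPt R) (orbitι f Q)) _ _
    (by rw [baseChangePoint_comp, orbitPoint_comp_orbitι])

theorem orbitCotangentProj_surjective (f : Z ⟶ Z) (Q : Point Z) :
    Function.Surjective (orbitCotangentProj f Q) := by
  have : IsClosedImmersion (orbitι f Q).left :=
    inferInstanceAs (IsClosedImmersion (orbitIdeal f Q).subschemeι)
  have : IsClosedImmersion (baseChangeMap (closedPt R) (orbitι f Q)).left :=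
    MorphismProperty.overPullbackMap (P := @IsClosedImmersion) _ _ inferInstance
  exact cotangentMap_surjective _ _ _ _

theorem cotangentMap_congr {k : Type u} [Field k] {Z Z' : Over (Spec (.of k))} {f f' : Z ⟶ Z'}
    (hf : f = f') (x : Point Z) (x' : Point Z') (h : x ≫ f = x') :
    cotangentMap f x x' h = cotangentMap f' x x' (hf ▸ h) := by
  subst hf; rfl

theorem orbitCotangentProj_reducedCotangentMap (f : Z ⟶ Z) (Q : Point Z)
    (v : reducedCotangent Q) :
    orbitCotangentProj f Q (reducedCotangentMap f Q v) =
      orbitCotangentMap f Q (orbitCotangentProj f Q v) := by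
  have hc : iter (baseChangeMap (closedPt R) (orbitMap f Q)) (reducedPeriod f Q) ≫
      baseChangeMap (closedPt R) (orbitι f Q) =
      baseChangeMap (closedPt R) (orbitι f Q) ≫
        iter (baseChangeMap (closedPt R) f) (reducedPeriod f Q) :=
    iter_comm _ _ _ (by rw [← Functor.map_comp, ← Functor.map_comp, orbitMap_comp_orbitι]) _
  have h1 : baseChangePoint (closedPt R) (orbitPoint f Q) ≫
      baseChangeMap (closedPt R) (orbitι f Q) = baseChangePoint (closedPt R) Q := by
    rw [baseChangePoint_comp, orbitPoint_comp_orbitι]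
  have h2 : baseChangePoint (closedPt R) (orbitPoint f Q) ≫
      baseChangeMap (closedPt R) (orbitι f Q) ≫
        iter (baseChangeMap (closedPt R) f) (reducedPeriod f Q) =
      baseChangePoint (closedPt R) Q := by
    rw [reassoc_of% h1]
    exact comp_iter_primitivePeriod _ _
  refine (cotangentMap_comp _ _ _ _ _ h1 (comp_iter_primitivePeriod _ _) h2 v).symm.trans ?_
  refine congr($(cotangentMap_congr hc.symm _ _ h2) v).trans ?_
  exact cotangentMap_comp _ _ _ _ _ (baseChangePoint_orbitPoint_fixed f Q) h1 (hc ▸ h2) v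

end OrbitCotangent

/-! ### Extending points from the generic fibre to the model. -/

section Extension

theorem baseChangePoint_genericPt_left_fst {R K : Type u} [CommRing R] [Field K] [Algebra R K]
    {Z : Over (Spec (.of R))} (Q : Point Z) :
    (baseChangePoint (genericPt R K) Q).left ≫ pullback.fst Z.hom (genericPt R K) =
      genericPt R K ≫ Q.left :=
  pullback.lift_fst _ _ _

variable {R K : Type u} [CommRing R] [IsDomain R] [IsDiscreteValuationRing R] [Field K]
  [Algebra R K] [IsFractionRing R K] {Z : Over (Spec (.of R))}

/-- Points of a proper scheme over the fraction field extend to sections. -/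
theorem exists_baseChangePoint_eq [IsProper Z.hom] (P : Point (baseChange (genericPt R K) Z)) :
    ∃ Q : Point Z, baseChangePoint (genericPt R K) Q = P := by
  have hP : P.left ≫ pullback.snd Z.hom (genericPt R K) = 𝟙 _ := Over.w P
  have hex : ValuativeCriterion.Existence Z.hom :=
    have h : (ValuativeCriterion.Existence ⊓ @QuasiCompact : MorphismProperty Scheme) Z.hom := by
      rw [← UniversallyClosed.eq_valuativeCriterion]
      infer_instance
    h.1
  obtain ⟨⟨⟨q, hq1, hq2⟩⟩⟩ := hex
    { R := R, K := K, i₁ := P.left ≫ pullback.fst Z.hom (genericPt R K), i₂ := 𝟙 _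
      commSq := ⟨by rw [Category.assoc, pullback.condition, reassoc_of% hP, Category.comp_id]⟩ }
  refine ⟨Over.homMk q hq2, ?_⟩
  ext1
  refine pullback.hom_ext ?_ ?_
  · exact (baseChangePoint_genericPt_left_fst _).trans hq1
  · exact (pullback.lift_snd _ _ _).trans hP.symm

/-- A section of a separated scheme is determined by its restriction to the generic fibre. -/
theorem baseChangePoint_genericPt_injective [IsSeparated Z.hom] :
    Function.Injective (baseChangePoint (genericPt R K) : Point Z → _) := by
  intro Q Q' h
  have h1 : genericPt R K ≫ Q.left = genericPt R K ≫ Q'.left := by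
    rw [← baseChangePoint_genericPt_left_fst, h, baseChangePoint_genericPt_left_fst]
  let S : ValuativeCommSq Z.hom :=
    { R := R, K := K, i₁ := genericPt R K ≫ Q.left, i₂ := 𝟙 _
      commSq := ⟨by rw [Category.assoc, show Q.left ≫ Z.hom = 𝟙 _ from Over.w Q]; rfl⟩ }
  have hs := IsSeparated.valuativeCriterion Z.hom S
  let l : S.commSq.LiftStruct := ⟨Q.left, rfl, Over.w Q⟩
  let l' : S.commSq.LiftStruct := ⟨Q'.left, h1.symm, Over.w Q'⟩
  ext1
  exact congrArg CommSq.LiftStruct.l (Subsingleton.elim l l')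

/-- A section of a model has the period of its restriction to the generic fibre. -/
theorem primitivePeriod_model {Y : Over (Spec (.of K))} {ψ : Y ⟶ Y} (M : GoodReductionModel R ψ)
    {PY : Point Y} {Q : Point M.scheme}
    (hQ : baseChangePoint (genericPt R K) Q ≫ M.genericIso.hom = PY) :
    primitivePeriod ψ PY = primitivePeriod M.map Q := by
  have := M.proper
  refine primitivePeriod_congr fun j => ?_
  rw [← (baseChangePoint_genericPt_injective (R := R) (K := K)).eq_iff, ← baseChangePoint_comp,
    ← iter_baseChangeMap, ← cancel_mono M.genericIso.hom, Category.assoc,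
    iter_comm _ _ _ M.comm, ← Category.assoc, hQ]

end Extension

/-! ### Cotangent spaces and dimensions of standard smooth algebras. -/

section Dimension

open TensorProduct

/-- The augmentation ideal of a standard smooth algebra of relative dimension `d` is generated by
`d` elements modulo its square. -/
theorem exists_ker_le_span_sup_sq {R C : Type u} [CommRing R] [CommRing C] [Algebra R C] {d : ℕ}
    [Nontrivial R] [Algebra.IsStandardSmoothOfRelativeDimension d R C] (e : C →ₐ[R] R) :
    ∃ s : Fin d → C, (∀ i, s i ∈ RingHom.ker e) ∧
      RingHom.ker e ≤ Ideal.span (Set.range s) ⊔ RingHom.ker e ^ 2 := by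
  have : Nontrivial C := e.toRingHom.domain_nontrivial
  have : Algebra.IsStandardSmooth R C :=
    Algebra.IsStandardSmoothOfRelativeDimension.isStandardSmooth d
  algebraize [e.toRingHom]
  have htower : IsScalarTower R C R := .of_algebraMap_eq fun r => (e.commutes r).symm
  have hsurj : Function.Surjective (algebraMap C R) := fun r => ⟨algebraMap R C r, e.commutes r⟩
  -- Smoothness makes `I/I² → R ⊗ Ω` a split injection; it is onto because `Ω[R⁄R] = 0`. Lifting a
  -- basis of the free module `Ω` gives the `d` generators.
  obtain ⟨l, hl⟩ := (Algebra.FormallySmooth.iff_split_injection (R := R) (P := C) (A := R)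
    hsurj).mp inferInstance
  have hinj : Function.Injective (KaehlerDifferential.kerCotangentToTensor R C R) :=
    Function.LeftInverse.injective (g := l) fun x => congr($hl x)
  have hs : Function.Surjective (KaehlerDifferential.kerCotangentToTensor R C R) := fun x =>
    (KaehlerDifferential.exact_kerCotangentToTensor_mapBaseChange R C R hsurj x).mp
      (Subsingleton.elim _ _)
  let b : Module.Basis (Fin d) C (Ω[C⁄R]) := Module.finBasisOfFinrankEq C _
    (Module.finrank_eq_of_rank_eq
      (Algebra.IsStandardSmoothOfRelativeDimension.rank_kaehlerDifferential (R := R) d))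
  have hx (i : Fin d) : ∃ x : RingHom.ker (algebraMap C R),
      KaehlerDifferential.kerCotangentToTensor R C R (Ideal.toCotangent _ x) = 1 ⊗ₜ b i := by
    obtain ⟨y, hy⟩ := hs (1 ⊗ₜ b i)
    obtain ⟨x, rfl⟩ := Ideal.toCotangent_surjective _ y
    exact ⟨x, hy⟩
  choose x hx using hx
  refine ⟨fun i => x i, fun i => (x i).2, fun a ha => ?_⟩
  let a' : RingHom.ker (algebraMap C R) := ⟨a, ha⟩
  let z := KaehlerDifferential.kerCotangentToTensor R C R (Ideal.toCotangent _ a')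
  have hz : z = ∑ i, (b.baseChange R).repr z i • ((1 : R) ⊗ₜ[C] b i) := by
    conv_lhs => rw [← (b.baseChange R).sum_repr z]
    simp only [Module.Basis.baseChange_apply]
  have h1 : Ideal.toCotangent _ a' = Ideal.toCotangent _
      (∑ i, algebraMap R C ((b.baseChange R).repr z i) • x i) := by
    refine hinj (hz.trans ?_)
    rw [map_sum, map_sum]
    refine Finset.sum_congr rfl fun i _ => ?_
    rw [map_smul, map_smul, hx, algebraMap_smul]
  have h2 := (Ideal.toCotangent_eq _).mp h1
  have h3 : a = (∑ i, algebraMap R C ((b.baseChange R).repr z i) • x i :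
      RingHom.ker (algebraMap C R)) + (a - (∑ i, algebraMap R C ((b.baseChange R).repr z i) • x i :
      RingHom.ker (algebraMap C R))) := by ring
  rw [h3]
  refine Submodule.add_mem_sup ?_ h2
  rw [AddSubmonoidClass.coe_finsetSum]
  exact Submodule.sum_mem _ fun i _ => Ideal.mul_mem_left _ _ (Ideal.subset_span ⟨i, rfl⟩)

/-- A bound on the dimension of a cotangent space by the number of generators modulo the square. -/
theorem finrank_cotangentSpace_le {k B C : Type*} [Field k] [CommRing B] [IsLocalRing B]
    [Algebra k B] [CommRing C] (g : C →+* B) {I : Ideal C} {d : ℕ} (s : Fin d → C)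
    (hI : I ≤ Ideal.span (Set.range s) ⊔ I ^ 2) (hs : ∀ i, g (s i) ∈ IsLocalRing.maximalIdeal B)
    (hB : IsLocalRing.maximalIdeal B = I.map g)
    (hk : ∀ b : B, ∃ c : k, b - algebraMap k B c ∈ IsLocalRing.maximalIdeal B) :
    FiniteDimensional k (IsLocalRing.CotangentSpace B) ∧
      Module.finrank k (IsLocalRing.CotangentSpace B) ≤ d := by
  let w : Fin d → IsLocalRing.CotangentSpace B := fun i => Ideal.toCotangent _ ⟨g (s i), hs i⟩
  -- Every element of `B` is a scalar of `k` modulo the maximal ideal, so spanning over `B` amounts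
  -- to spanning over `k`.
  have hsmul (b : B) (v : IsLocalRing.CotangentSpace B) : ∃ c : k, b • v = c • v := by
    obtain ⟨c, hc⟩ := hk b
    refine ⟨c, ?_⟩
    have h1 : (b - algebraMap k B c) • v = 0 := Ideal.Cotangent.smul_eq_zero_of_mem hc v
    rw [← algebraMap_smul B c v, ← sub_eq_zero, ← sub_smul, h1]
  have hspan : Submodule.span k (Set.range w) = ⊤ := by
    refine top_le_iff.mp fun v _ => ?_
    obtain ⟨⟨b, hb⟩, rfl⟩ := Ideal.toCotangent_surjective _ v
    have h1 : IsLocalRing.maximalIdeal B ≤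
        Ideal.span (Set.range (g ∘ s)) ⊔ IsLocalRing.maximalIdeal B ^ 2 := by
      conv_lhs => rw [hB]
      refine (Ideal.map_mono hI).trans ?_
      rw [Ideal.map_sup, Ideal.map_pow, ← hB, Ideal.map_span, Set.range_comp]
    obtain ⟨y, hy, z, hz, hyz⟩ := Submodule.mem_sup.mp (h1 hb)
    obtain ⟨c, hc⟩ := (Submodule.mem_span_range_iff_exists_fun B).mp hy
    have h2 : Ideal.toCotangent _ (⟨b, hb⟩ : IsLocalRing.maximalIdeal B) = ∑ i, c i • w i := by
      have h3 : ∑ i, c i • w i = Ideal.toCotangent _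
          (∑ i, c i • (⟨g (s i), hs i⟩ : IsLocalRing.maximalIdeal B)) := by
        rw [map_sum]
        simp only [map_smul, w]
      rw [h3, Ideal.toCotangent_eq, AddSubmonoidClass.coe_finsetSum]
      have h4 : b - y ∈ IsLocalRing.maximalIdeal B ^ 2 := by
        rwa [← hyz, add_sub_cancel_left]
      rwa [← hc] at h4
    rw [h2]
    refine Submodule.sum_mem _ fun i _ => ?_
    obtain ⟨κ, hκ⟩ := hsmul (c i) (w i)
    rw [hκ]
    exact Submodule.smul_mem _ _ (Submodule.subset_span ⟨i, rfl⟩)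
  classical
  refine ⟨⟨⟨Finset.univ.image w, by simpa using hspan⟩⟩, ?_⟩
  have h5 := finrank_range_le_card (R := k) w
  rwa [Set.finrank, hspan, finrank_top, Fintype.card_fin] at h5

/-- Rational points of affine space of dimension `n` have height `n`. -/
theorem height_ker_mvPolynomial {K : Type*} [Field K] (n : ℕ)
    (f : MvPolynomial (Fin n) K →ₐ[K] K) : (n : ℕ∞) ≤ (RingHom.ker f).height := by
  induction n with
  | zero => simp
  | succ n ih =>
    let E := MvPolynomial.finSuccEquiv K n
    let f' : Polynomial (MvPolynomial (Fin n) K) →ₐ[K] K := f.comp E.symm.toAlgHom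
    let f0 : MvPolynomial (Fin n) K →ₐ[K] K := f'.comp (Algebra.ofId _ _ |>.restrictScalars K)
    have hmax : (RingHom.ker f').IsMaximal :=
      RingHom.ker_isMaximal_of_surjective f' fun c => ⟨algebraMap K _ c, f'.commutes c⟩
    have hover : (RingHom.ker f').LiesOver (RingHom.ker f0) := ⟨rfl⟩
    -- A maximal ideal of a polynomial ring in one variable has height one more than its contraction
    -- to the coefficients.
    have h1 := Polynomial.height_eq_height_add_one (RingHom.ker f0) (RingHom.ker f')
    have h2 : (RingHom.ker f').height = (RingHom.ker f).height := by
      have h3 : RingHom.ker f' = (RingHom.ker f).comap E.symm.toRingEquiv.toRingHom := rfl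
      rw [h3]
      exact RingEquiv.height_comap E.symm.toRingEquiv _
    rw [← h2, h1]
    push_cast
    gcongr
    exact ih f0

/-- The rational point has height at least the number of variables in the presenting polynomial
ring, and each relation lowers the dimension by at most one. The difference of the two numbers is
`d`. -/
theorem le_ringKrullDim_of_isStandardSmooth {K D : Type*} [Field K] [CommRing D] [Algebra K D]
    {d : ℕ} [H : Algebra.IsStandardSmoothOfRelativeDimension d K D] (e : D →ₐ[K] K) :
    (d : WithBot ℕ∞) ≤ ringKrullDim D := by
  obtain ⟨ι, σ, _, _, P, hP⟩ := H.out
  have := Fintype.ofFinite ι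
  have := Fintype.ofFinite σ
  let r := MvPolynomial.renameEquiv K (Fintype.equivFin ι).symm
  let f : MvPolynomial ι K →ₐ[K] K := e.comp (MvPolynomial.aeval P.val)
  have hmax : (RingHom.ker f).IsMaximal :=
    RingHom.ker_isMaximal_of_surjective f fun c => ⟨algebraMap K _ c, f.commutes c⟩
  have hh : (Fintype.card ι : ℕ∞) ≤ (RingHom.ker f).height := by
    have h1 := height_ker_mvPolynomial (Fintype.card ι) (f.comp r.toAlgHom)
    have h3 : RingHom.ker (f.comp r.toAlgHom) =
      (RingHom.ker f).comap r.toRingEquiv.toRingHom := rfl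
    rw [h3] at h1
    exact h1.trans (RingEquiv.height_comap r.toRingEquiv _).le
  have hsub : Set.range P.relation ⊆ RingHom.ker f := by
    rintro _ ⟨i, rfl⟩
    have h1 : MvPolynomial.aeval P.val (P.relation i) = 0 := P.aeval_val_relation i
    change e (MvPolynomial.aeval P.val (P.relation i)) = 0
    rw [h1, map_zero]
  have h2 := Ideal.height_le_ringKrullDim_quotient_add_encard (Set.range P.relation) hsub
  have h3 : ringKrullDim (MvPolynomial ι K ⧸ Ideal.span (Set.range P.relation)) =
      ringKrullDim D := by
    have h4 : Ideal.span (Set.range P.relation) = RingHom.ker (MvPolynomial.aeval (R := K) P.val) := by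
      rw [P.span_range_relation_eq_ker, P.ker_eq_ker_aeval_val]
    rw [h4]
    exact ringKrullDim_eq_of_ringEquiv (RingHom.quotientKerEquivOfSurjective
      (f := (MvPolynomial.aeval (R := K) P.val).toRingHom) P.aeval_val_surjective)
  rw [h3] at h2
  have h5 : ((Set.range P.relation).encard : WithBot ℕ∞) ≤ (Fintype.card σ : WithBot ℕ∞) := by
    have h6 : (Set.range P.relation).encard ≤ (Fintype.card σ : ℕ∞) := by
      rw [← Set.image_univ]
      refine (Set.encard_image_le _ _).trans ?_
      simp
    exact_mod_cast h6
  have h7 : (Fintype.card ι : WithBot ℕ∞) ≤ ringKrullDim D + (Fintype.card σ : WithBot ℕ∞) := by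
    refine le_trans ?_ (h2.trans (add_le_add_right h5 _))
    exact_mod_cast hh
  have h8 : d + Fintype.card σ ≤ Fintype.card ι := by
    rw [← hP, Algebra.Presentation.dimension, Nat.card_eq_fintype_card, Nat.card_eq_fintype_card]
    refine (Nat.sub_add_cancel ?_).le
    exact Fintype.card_le_of_injective _ P.map_inj
  have h9 : (d : WithBot ℕ∞) + (Fintype.card σ : WithBot ℕ∞) ≤
      ringKrullDim D + (Fintype.card σ : WithBot ℕ∞) := by
    refine le_trans ?_ h7
    exact_mod_cast h8
  -- Cancelling the finite summand needs a case distinction, as the dimension may a priori be `⊥` or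
  -- `⊤`.
  generalize ringKrullDim D = t at h9
  cases t with
  | bot =>
    rw [WithBot.bot_add] at h9
    exact absurd h9 (not_le.mpr (by exact_mod_cast WithBot.bot_lt_coe ((d + Fintype.card σ : ℕ) : ℕ∞)))
  | coe t =>
    cases t with
    | top => exact WithBot.coe_le_coe.mpr le_top
    | coe t =>
      have h10 : d + Fintype.card σ ≤ t + Fintype.card σ := by exact_mod_cast h9
      exact_mod_cast Nat.le_of_add_le_add_right h10

end Dimension

/-! ### Smooth charts around a section. -/

section SmoothChart

open TensorProduct

/-- A smooth scheme over a local ring has a standard smooth affine chart around a section. -/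
theorem exists_isStandardSmooth_chart {R : Type u} [CommRing R] [IsLocalRing R]
    {Z : Over (Spec (.of R))} [Smooth Z.hom] (Q : Point Z) :
    ∃ (C : Type u) (_ : CommRing C) (_ : Algebra R C) (d : ℕ)
      (_ : Algebra.IsStandardSmoothOfRelativeDimension d R C) (j : Spec (.of C) ⟶ Z.left)
      (_ : IsOpenImmersion j) (e : C →ₐ[R] R),
      j ≫ Z.hom = Spec.map (CommRingCat.ofHom (algebraMap R C)) ∧
      Spec.map (CommRingCat.ofHom e.toRingHom) ≫ j = Q.left := by
  obtain ⟨U, hU, V, hV, hQV, hVU, hst⟩ := Smooth.exists_isStandardSmooth Z.hom Q.closed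
  have hQ : Q.left ≫ Z.hom = 𝟙 _ := Over.w Q
  -- An open subset of a local scheme containing the closed point is everything. The same reason
  -- puts the whole section inside the chart.
  have hUtop : U = ⊤ := by
    refine IsLocalRing.closed_point_mem_iff.mp ?_
    have h1 : Z.hom Q.closed = IsLocalRing.closedPoint R :=
      congr($hQ (IsLocalRing.closedPoint R))
    rw [← h1]
    exact hVU hQV
  subst hUtop
  let a : CommRingCat.of R ⟶ Γ(Z.left, V) := (Scheme.ΓSpecIso (.of R)).inv ≫ Z.hom.appLE ⊤ V hVU
  have ha : a.hom.IsStandardSmooth :=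
    RingHom.isStandardSmooth_respectsIso.2 _ (Scheme.ΓSpecIso (.of R)).symm.commRingCatIsoToRingEquiv
      hst
  algebraize [a.hom]
  have hmap : hV.fromSpec ≫ Z.hom = Spec.map a := by
    rw [Spec.map_comp, ← IsAffineOpen.SpecMap_appLE_fromSpec _ hU hV hVU]
    congr 1
    rw [IsAffineOpen.fromSpec_top, Scheme.isoSpec_Spec_inv]
  obtain ⟨ι, σ, _, _, ⟨P⟩⟩ := ha
  have hd : Algebra.IsStandardSmoothOfRelativeDimension P.dimension R Γ(Z.left, V) :=
    P.isStandardSmoothOfRelativeDimension rfl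
  have hrange : Set.range Q.left ⊆ Set.range hV.fromSpec := by
    rw [hV.range_fromSpec]
    have h1 : Q.left ⁻¹ᵁ V = ⊤ := IsLocalRing.closed_point_mem_iff.mp hQV
    rintro _ ⟨x, rfl⟩
    exact h1.ge (show x ∈ ⊤ from trivial)
  let e : Γ(Z.left, V) ⟶ CommRingCat.of R :=
    Spec.preimage (IsOpenImmersion.lift hV.fromSpec Q.left hrange)
  have he : Spec.map e ≫ hV.fromSpec = Q.left := by
    rw [Spec.map_preimage, IsOpenImmersion.lift_fac]
  have hae : a ≫ e = 𝟙 _ := by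
    refine Spec.map_injective ?_
    rw [Spec.map_comp, ← hmap, reassoc_of% he, hQ, Spec.map_id]
    rfl
  exact ⟨Γ(Z.left, V), inferInstance, inferInstance, P.dimension, hd, hV.fromSpec, inferInstance,
    { e.hom with commutes' := fun r => congr($hae r) }, hmap, he⟩

/-- The generic fibre of the chart is open in that of `Z`, and base change of `e` gives it a
rational point, so its dimension is at least `d`. -/
theorem le_topologicalKrullDim_genericFibre {R K : Type u} [CommRing R] [Field K] [Algebra R K]
    {Z : Over (Spec (.of R))} {C : Type u} [CommRing C] [Algebra R C] {d : ℕ}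
    [Algebra.IsStandardSmoothOfRelativeDimension d R C] (j : Spec (.of C) ⟶ Z.left)
    [IsOpenImmersion j] (e : C →ₐ[R] R)
    (hj : j ≫ Z.hom = Spec.map (CommRingCat.ofHom (algebraMap R C))) :
    (d : WithBot ℕ∞) ≤ topologicalKrullDim (baseChange (genericPt R K) Z).left := by
  let J : Over.mk (Spec.map (CommRingCat.ofHom (algebraMap R C))) ⟶ Z := Over.homMk j hj
  have hJ : IsOpenImmersion (baseChangeMap (genericPt R K) J).left :=
    MorphismProperty.overPullbackMap (P := @IsOpenImmersion) _ _ (inferInstanceAs (IsOpenImmersion j))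
  let i : Spec (.of (C ⊗[R] K)) ⟶ (baseChange (genericPt R K) Z).left :=
    (pullbackSpecIso R C K).inv ≫ (baseChangeMap (genericPt R K) J).left
  have hi : IsOpenImmersion i := inferInstance
  have h1 : topologicalKrullDim (Spec (.of (C ⊗[R] K))) ≤
      topologicalKrullDim (baseChange (genericPt R K) Z).left :=
    i.isOpenEmbedding.isInducing.topologicalKrullDim_le
  refine le_trans ?_ h1
  have h2 : topologicalKrullDim (Spec (.of (C ⊗[R] K))) = ringKrullDim (K ⊗[R] C) :=
    (PrimeSpectrum.topologicalKrullDim_eq_ringKrullDim _).trans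
      (ringKrullDim_eq_of_ringEquiv (Algebra.TensorProduct.comm R C K).toRingEquiv)
  rw [h2]
  exact le_ringKrullDim_of_isStandardSmooth (K := K)
    (Algebra.TensorProduct.lift (Algebra.ofId K K) ((Algebra.ofId R K).comp e) fun _ _ => .all _ _)

/-- In a chart, the augmentation ideal of the local ring along a section is generated by the
augmentation ideal of the chart. -/
theorem exists_chart_sectionRing {R : Type u} [CommRing R] [IsLocalRing R]
    {Z : Over (Spec (.of R))} {Q : Point Z} {C : Type u} [CommRing C] [Algebra R C]
    (j : Spec (.of C) ⟶ Z.left) [IsOpenImmersion j] (e : C →ₐ[R] R)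
    (he : Spec.map (CommRingCat.ofHom e.toRingHom) ≫ j = Q.left) {ε : SectionRing Q →ₐ[R] R}
    (hε : Spec.map (CommRingCat.ofHom ε.toRingHom) ≫ fromSpecSectionRing Q = Q.left) :
    ∃ c : C →+* SectionRing Q, RingHom.ker ε = (RingHom.ker e).map c := by
  let y : PrimeSpectrum C := PrimeSpectrum.comap e.toRingHom (IsLocalRing.closedPoint R)
  have hy : j y = Q.closed := congr($he (IsLocalRing.closedPoint R))
  obtain ⟨θ, hθ, -, -, hbij⟩ := exists_stalk_hom j hy
  let L := (Spec (.of C)).presheaf.stalk y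
  let Θ : SectionRing Q ≃+* L := RingEquiv.ofBijective θ.hom (hbij inferInstance)
  let algL : Algebra C L := (StructureSheaf.toStalk C y).hom.toAlgebra
  have hL : IsLocalization.AtPrime L y.asIdeal := inferInstanceAs
    (IsLocalization.AtPrime ((Spec.structureSheaf C).presheaf.stalk y) y.asIdeal)
  let c : C →+* SectionRing Q := Θ.symm.toRingHom.comp (algebraMap C L)
  have hc : Spec.map (CommRingCat.ofHom c) ≫ j = fromSpecSectionRing Q := by
    have h1 : Spec.map (CommRingCat.ofHom (algebraMap C L)) = (Spec (.of C)).fromSpecStalk y :=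
      (Spec.fromSpecStalk_eq' _ _).symm
    have h2 : Spec.map (CommRingCat.ofHom Θ.toRingHom) ≫ fromSpecSectionRing Q =
      Spec.map (CommRingCat.ofHom (algebraMap C L)) ≫ j := by rw [h1]; exact hθ
    have h3 : Spec.map (CommRingCat.ofHom c) = Spec.map (CommRingCat.ofHom Θ.symm.toRingHom) ≫
        Spec.map (CommRingCat.ofHom (algebraMap C L)) := by
      rw [← Spec.map_comp]; rfl
    have h4 : Spec.map (CommRingCat.ofHom Θ.symm.toRingHom) ≫
        Spec.map (CommRingCat.ofHom Θ.toRingHom) = 𝟙 _ := by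
      rw [← Spec.map_comp, ← CommRingCat.ofHom_comp, ← Spec.map_id]
      congr 1
      ext a
      exact Θ.symm_apply_apply a
    rw [h3, Category.assoc, ← h2, reassoc_of% h4]
  have hεc : ε.toRingHom.comp c = e.toRingHom := by
    have h1 : Spec.map (CommRingCat.ofHom (ε.toRingHom.comp c)) ≫ j =
        Spec.map (CommRingCat.ofHom e.toRingHom) ≫ j := by
      rw [CommRingCat.ofHom_comp, Spec.map_comp, Category.assoc, hc, hε, he]
    exact congrArg CommRingCat.Hom.hom (Spec.map_injective ((cancel_mono j).mp h1))
  refine ⟨c, le_antisymm (fun a ha => ?_) ?_⟩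
  -- The local ring is a localization of `C`; clearing the denominator of `a` leaves a numerator in
  -- the kernel of `e`.
  · obtain ⟨⟨x, s⟩, hx⟩ := IsLocalization.surj y.asIdeal.primeCompl (Θ a)
    have h2 : a * c s = c x := Θ.injective (by
      rw [map_mul]
      simpa [c] using hx)
    have hu : IsUnit (c s) := (IsLocalization.map_units L s).map Θ.symm
    have h3 : x ∈ RingHom.ker e := by
      have h4 : e x = ε (c x) := congr($hεc x).symm
      rw [RingHom.mem_ker, h4, ← h2, map_mul, show ε a = 0 from ha, zero_mul]
    have h5 : a = c x * ↑hu.unit⁻¹ := by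
      rw [← h2, mul_assoc, IsUnit.mul_val_inv, mul_one]
    rw [h5]
    exact Ideal.mul_mem_right _ _ (Ideal.mem_map_of_mem c h3)
  · rw [Ideal.map_le_iff_le_comap]
    intro x hx
    exact (congr($hεc x) : ε (c x) = e x).trans hx

/-- The cotangent space of the special fibre of a smooth scheme at the reduction of a section has
dimension at most that of the generic fibre. -/
theorem finrank_reducedCotangent_le {R K : Type u} [CommRing R] [IsDomain R]
    [IsDiscreteValuationRing R] [Field K] [Algebra R K] {Z : Over (Spec (.of R))} [Smooth Z.hom]
    (Q : Point Z) :
    FiniteDimensional (IsLocalRing.ResidueField R) (reducedCotangent Q) ∧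
    (Module.finrank (IsLocalRing.ResidueField R) (reducedCotangent Q) : WithBot ℕ∞) ≤
      topologicalKrullDim (baseChange (genericPt R K) Z).left := by
  obtain ⟨C, _, _, d, _, j, _, e, hj, he⟩ := exists_isStandardSmooth_chart Q
  obtain ⟨ε, hε⟩ := exists_augmentation Q
  obtain ⟨c, hc⟩ := exists_chart_sectionRing j e he hε
  obtain ⟨g, hg, hgr, -, -⟩ := exists_reduction Q
  obtain ⟨ϖ, hϖ⟩ := IsDiscreteValuationRing.exists_irreducible R
  have hgϖ : g (algebraMap R _ ϖ) = 0 := by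
    rw [hgr, (IsLocalRing.residue_eq_zero_iff ϖ).mpr, map_zero]
    exact hϖ.not_isUnit
  have hm : IsLocalRing.maximalIdeal (LocalRingAt (baseChangePoint (closedPt R) Q)) =
      (RingHom.ker e).map (g.comp c) := by
    rw [maximalIdeal_eq_map_ker (ε := ε) hϖ hg hgϖ, hc, Ideal.map_map]
  obtain ⟨s, hs0, hs⟩ := exists_ker_le_span_sup_sq (d := d) e
  obtain ⟨hfin, hle⟩ := finrank_cotangentSpace_le (k := IsLocalRing.ResidueField R) (g.comp c) s hs
    (fun i => hm ▸ Ideal.mem_map_of_mem _ (hs0 i)) hm fun b => by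
      obtain ⟨a, rfl⟩ := hg b
      refine ⟨IsLocalRing.residue R (ε a), ?_⟩
      rw [← hgr, ← map_sub, maximalIdeal_eq_map_ker (ε := ε) hϖ hg hgϖ]
      exact Ideal.mem_map_of_mem g (sub_algebraMap_mem_ker a)
  exact ⟨hfin, le_trans (by exact_mod_cast hle)
    (le_topologicalKrullDim_genericFibre (K := K) j e hj)⟩

end SmoothChart

end EtalePeriodic

/-! ### The main theorem. -/

open EtalePeriodic in
theorem mainTheorem4
    {R K : Type u} [CommRing R] [IsDomain R] [IsDiscreteValuationRing R]
    [IsAdicComplete (IsLocalRing.maximalIdeal R) R]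
    [Field K] [Algebra R K] [IsFractionRing R K]
    [Finite (IsLocalRing.ResidueField R)]
    (p : ℕ) [CharP (IsLocalRing.ResidueField R) p]
    (X : Over (Spec (.of K))) (hX : IsProjectiveVariety X)
    (φ : X ⟶ X) (hφ : Etale φ.left)
    (P : Point X) (n : ℕ) (hn : 0 < n) (hPn : primitivePeriod φ P = n)
    (hPsmooth : P.pt ∈ smoothLocus X)
    (Y : X.left.Opens)
    (hY : Maximal (fun s : Set X.left => IsIrreducible s ∧ s ⊆ smoothLocus X) (Y : Set X.left))
    (PY : Point (openSubscheme Y)) (hPY : PY ≫ openInclusion Y = P) :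
    ∃ l : ℕ,
      IsLeast {j : ℕ | 0 < j ∧ ∃ ψ : openSubscheme Y ⟶ openSubscheme Y,
        Etale ψ.left ∧ ψ ≫ openInclusion Y = openInclusion Y ≫ iter φ j} l ∧
      ∀ ψ : openSubscheme Y ⟶ openSubscheme Y,
        ψ ≫ openInclusion Y = openInclusion Y ≫ iter φ l →
        ∀ M : GoodReductionModel R ψ,
          ∃ PR : Point M.scheme,
            baseChangePoint (genericPt R K) PR ≫ M.genericIso.hom = PY ∧
            (n = l * reducedPeriod M.map PR ∨
              ((∃ (W : Submodule (IsLocalRing.ResidueField R) (reducedCotangent PR))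
                  (hW : ∀ w ∈ W, reducedCotangentMap M.map PR w ∈ W)
                  (ι : W ≃ₗ[IsLocalRing.ResidueField R] orbitCotangent M.map PR),
                  ∀ w, ι ((reducedCotangentMap M.map PR).restrict hW w) =
                    orbitCotangentMap M.map PR (ι w)) ∧
                ((Module.finrank (IsLocalRing.ResidueField R)
                  (orbitCotangent M.map PR) : ℕ) : WithBot ℕ∞) ≤ topologicalKrullDim Y ∧
                orderOf (orbitCotangentMap M.map PR) ≤
                  Nat.card (IsLocalRing.ResidueField R) ^
                    Module.finrank (IsLocalRing.ResidueField R) (orbitCotangent M.map PR) - 1 ∧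
                (n = l * reducedPeriod M.map PR * orderOf (orbitCotangentMap M.map PR) ∨
                  ∃ e : ℕ,
                    n = l * reducedPeriod M.map PR *
                      orderOf (orbitCotangentMap M.map PR) * p ^ e ∧
                    ∀ v : ℕ, IsDiscreteValuationRing.addVal R (p : R) = v →
                      ExponentBound p v e))) := by
  have := hX.locallyOfFinitePresentation
  have hPY' : P.pt ∈ Y := by
    rw [pt_comp _ _ _ hPY]
    exact PY.pt.2
  have hpos : 0 < primitivePeriod φ P := hPn ▸ hn
  obtain ⟨l, hl, hln⟩ := exists_isLeast_restrict φ hφ P hpos Y hY hPY'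
  refine ⟨l, hl, fun ψ hψ M => ?_⟩
  have := M.proper
  have := M.smooth
  obtain ⟨PR, hPR⟩ := exists_baseChangePoint_eq (PY ≫ M.genericIso.inv)
  have hPR' : baseChangePoint (genericPt R K) PR ≫ M.genericIso.hom = PY := by
    rw [hPR, Category.assoc, Iso.inv_hom_id, Category.comp_id]
  refine ⟨PR, hPR', ?_⟩
  have hn' : n = l * primitivePeriod M.map PR := by
    rw [← primitivePeriod_model M hPR', ← primitivePeriod_eq_mul_of_restrict hln hψ hPY, hPn]
  obtain ⟨⟨e, he, hb⟩, h0⟩ := primitivePeriod_eq_reducedPeriod_mul p M.map PR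
    (Nat.pos_of_mul_pos_left (hn' ▸ hn))
  -- The two alternatives of the theorem: for zero cotangent space the bound `q ^ 0 - 1 = 0` would
  -- fail, but then the section does not move after `m` steps.
  rcases subsingleton_or_nontrivial (orbitCotangent M.map PR) with hV | hV
  · exact Or.inl (by rw [hn', h0 hV])
  obtain ⟨hfin, hdim⟩ := finrank_reducedCotangent_le (K := K) PR
  have hfinV : FiniteDimensional (IsLocalRing.ResidueField R) (orbitCotangent M.map PR) :=
    Module.Finite.of_surjective _ (orbitCotangentProj_surjective M.map PR)
  obtain ⟨W, hW, ι, hι⟩ := exists_submodule_equiv_of_surjective (reducedCotangentMap M.map PR)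
    (orbitCotangentMap M.map PR) (orbitCotangentProj M.map PR)
    (orbitCotangentProj_surjective M.map PR) (orbitCotangentProj_reducedCotangentMap M.map PR)
  -- The exponent `e` may be `0`, so the form with `p ^ e` always applies. The bound is asserted
  -- only for finite `v(p)`.
  refine Or.inr ⟨⟨W, hW, ι, hι⟩, ?_, orderOf_end_le _, Or.inr ⟨e, ?_, hb⟩⟩
  · have h1 : Module.finrank (IsLocalRing.ResidueField R) (orbitCotangent M.map PR) ≤
        Module.finrank (IsLocalRing.ResidueField R) (reducedCotangent PR) := by
      rw [← ι.finrank_eq]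
      exact W.finrank_le
    have h2 : IsIso M.genericIso.hom.left :=
      inferInstanceAs (IsIso ((Over.forget _).map M.genericIso.hom))
    have h3 : topologicalKrullDim (baseChange (genericPt R K) M.scheme).left ≤
        topologicalKrullDim Y :=
      M.genericIso.hom.left.isOpenEmbedding.isInducing.topologicalKrullDim_le
    exact le_trans (by exact_mod_cast h1) (hdim.trans h3)
  · rw [hn', he]
    ring
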